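/- Let $\Omega=[0,1]^{\mathbb Z\times\mathbb N}$ (with $\mathbb N=\{1,2,\dots\}$ and the product Borel $\sigma$-field), and let $\mathbb P$ be a probability measure on $\Omega$, with expectation $\mathbb E$, such that for some integer $M\ge 0$: - (IID) the cookie stacks $\omega(z,\cdot)$, $z\in\mathbb Z$, are independent and identically distributed under $\mathbb P$; - (WEL) for every $z\in\mathbb Z$, $\mathbb P[\forall i\in\mathbb N:\ \omega(z,i)>0]>0$ and $\mathbb P[\forall i\in\mathbb N:\ \omega(z,i)<1]>0$; - (BD$_M$) $\mathbb P$-a.s., $\omega(z,i)=1/2$ for all $z\in\mathbb Z$ and all $i>M$. Let $\delta:=\mathbb E\big[\sum_{i\ge1}(2\omega(0,i)-1)\big]$. For $x\in\mathbb Z$ and $\omega\in\Omega$, let $(X_n)_{n\ge0}$ be under $P_{x,\omega}$ an excited random walk started at $x$ in the environment $\omega$, i.e. a $\mathbb Z$-valued process with $P_{x,\omega}[X_0=x]=1$ and, for all $n\ge0$, $$P_{x,\omega}[X_{n+1}=X_n+1\mid X_0,\dots,X_n]=\omega\big(X_n,\#\{i\le n: X_i=X_n\}\big),$$ $$P_{x,\omega}[X_{n+1}=X_n-1\mid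 X_0,\dots,X_n]=1-\omega\big(X_n,\#\{i\le n: X_i=X_n\}\big),$$ where $P_{x,\omega}$ depends measurably on $\omega$, and let $P_x[\cdot]=\mathbb E[P_{x,\omega}[\cdot]]$ be the averaged measure. Then for every $x\in\mathbb Z$: - if $|\delta|<1$, then $P_x$-a.s. $X_n=x$ for infinitely many $n$; - if $\delta>1$, then $P_x$-a.s. $X_n\to+\infty$ as $n\to\infty$; - if $\delta<-1$, then $P_x$-a.s. $X_n\to-\infty$ as $n\to\infty$. -/

import Mathlib

open MeasureTheory ProbabilityTheory Filter
open scoped ProbabilityTheory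

/-- Cookie environments on the integers, with the product Borel sigma-field. Cookies are numbered
from `0`: `ω z i` is the `(i + 1)`-th cookie at the site `z`, that is, the probability of stepping
from `z` to `z + 1` upon the `(i + 1)`-th visit to `z`. -/
abbrev CookieEnv : Type := ℤ → ℕ → unitInterval

/-- (IID): the cookie stacks at the different sites are independent and identically distributed. -/
def CookieIID (P : Measure CookieEnv) : Prop :=
  iIndepFun (fun (z : ℤ) (ω : CookieEnv) => ω z) P ∧
    ∀ z : ℤ, IdentDistrib (fun ω : CookieEnv => ω z) (fun ω : CookieEnv => ω 0) P P

/-- (WEL): weak ellipticity. -/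
def CookieWEL (P : Measure CookieEnv) : Prop :=
  ∀ z : ℤ, 0 < P {ω | ∀ i, 0 < (ω z i : ℝ)} ∧ 0 < P {ω | ∀ i, (ω z i : ℝ) < 1}

/-- (BD_M): almost surely, all cookies after the `M`-th one at each site are equal to `1 / 2`. -/
def CookieBD (M : ℕ) (P : Measure CookieEnv) : Prop :=
  ∀ᵐ ω ∂P, ∀ z : ℤ, ∀ i : ℕ, M ≤ i → (ω z i : ℝ) = 1 / 2

/-- The drift parameter: the expected total displacement caused by the cookies at one site.
Under `CookieBD M P` the series is almost surely a finite sum. -/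
noncomputable def cookieDrift (P : Measure CookieEnv) : ℝ :=
  ∫ ω, ∑' i : ℕ, (2 * (ω 0 i : ℝ) - 1) ∂P

/-- The sigma-field generated by `X 0, …, X n`. -/
@[reducible]
def pastSigma {Ω' : Type*} (X : ℕ → Ω' → ℤ) (n : ℕ) : MeasurableSpace Ω' :=
  ⨆ i ∈ Finset.range (n + 1), MeasurableSpace.comap (X i) inferInstance

/-- The number of visits to the current site `X n` strictly before time `n`. As cookies are numbered
from `0`, this is the number of the cookie used at time `n`. -/
def priorVisits {Ω' : Type*} (X : ℕ → Ω' → ℤ) (n : ℕ) (w : Ω') : ℕ :=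
  ((Finset.range n).filter fun i => X i w = X n w).card

/-- Under `μ` the process `X` is an excited random walk started at `x` in the environment `ω`. -/
structure IsExcitedRandomWalk {Ω' : Type*} [MeasurableSpace Ω'] (μ : Measure Ω')
    (ω : CookieEnv) (x : ℤ) (X : ℕ → Ω' → ℤ) : Prop where
  measurable : ∀ n, Measurable (X n)
  start : ∀ᵐ w ∂μ, X 0 w = x
  step_right : ∀ n, μ⟦{w | X (n + 1) w = X n w + 1} | pastSigma X n⟧
    =ᵐ[μ] fun w => (ω (X n w) (priorVisits X n w) : ℝ)
  step_left : ∀ n, μ⟦{w | X (n + 1) w = X n w - 1} | pastSigma X n⟧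
    =ᵐ[μ] fun w => 1 - (ω (X n w) (priorVisits X n w) : ℝ)

/-! Put at every site an infinite stack of arrows, the `i`-th one pointing right with the
probability given by the `i`-th cookie. Once the stacks are fixed the walk is deterministic: at each
visit it follows the next unused arrow. As the cookie stacks are i.i.d., so are the arrow stacks,
and the averaged law of the excited random walk is the law of this arrow walk
(`map_compProd_eq_map_arrowLaw`). Almost surely every stack has infinitely many arrows of both
kinds, so the walk returns to its start infinitely often or is transient to one side
(`IsStackWalk.trichotomy`). It remains to exclude alternatives.

Right excursions from `x` are encoded by a branching process: if the edge from `x + k` to `x + k +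
1` is crossed upwards `V` times and every crossing is undone, then the next edge is crossed upwards
as often as there are right arrows before the `V`-th left arrow at `x + k + 1`. Counting crossings
shows that transience to the right makes this process survive from some initial value, while
recurrence makes it die out from every initial value.

From a large state `n` the process has mean increment `δ` and variance of order `2n`, so on smooth
functions it acts like `n f'' + δ f'`. For `f = log` this is `(δ - 1) / n`, negative when `δ < 1`: a
Lyapunov function tending to infinity, which forces extinction (`ae_branching_extinct`). For `f = n
^ (-a)` it has the sign of `a + 1 - δ`, negative for small `a` when `δ > 1`: a supersolution tending
to zero, which bounds the extinction probability (`ae_exists_branching_survives`). To make this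
exact, a stack is explored arrow by arrow with functions `logSup` and `powSup` that are
superharmonic for fair arrows; the first `M` arrows enter only through an affine bound, whose mean
involves `δ`.

Thus `δ < 1` excludes transience to the right and `δ > 1` excludes recurrence. Reflection of the
line gives the corresponding facts for `-δ`, and the three cases of the theorem follow from the
trichotomy. -/

open scoped ENNReal

/-! ### Arrow stacks, their counting functions and the branching process -/

/-- The number of visits of the path `w` to the site `z` strictly before time `n`. -/
def visits (w : ℕ → ℤ) (n : ℕ) (z : ℤ) : ℕ :=
  ((Finset.range n).filter fun i => w i = z).card

/-- The displacement caused by an arrow; `true` is an arrow to the right. -/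
def arrowSign (b : Bool) : ℤ := if b then 1 else -1

/-- The path `w` starts at `x` and, at each visit to a site, follows the next unused arrow of the
stack of arrows at that site. -/
structure IsStackWalk (η : ℤ → ℕ → Bool) (x : ℤ) (w : ℕ → ℤ) : Prop where
  start : w 0 = x
  step : ∀ n, w (n + 1) = w n + arrowSign (η (w n) (visits w n (w n)))

/-- The number of right arrows among the first `t` arrows of a stack. -/
def rights (s : ℕ → Bool) (t : ℕ) : ℕ := Nat.count (fun i => s i = true) t

/-- The number of left arrows among the first `t` arrows of a stack. -/
def lefts (s : ℕ → Bool) (t : ℕ) : ℕ := Nat.count (fun i => s i = false) t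

/-- The stack contains infinitely many arrows in both directions. -/
def GoodStack (s : ℕ → Bool) : Prop := (∃ᶠ i in atTop, s i = true) ∧ ∃ᶠ i in atTop, s i = false

/-- The number of right arrows in a stack before its `n`-th left arrow. -/
noncomputable def rightsBefore (s : ℕ → Bool) (n : ℕ) : ℕ := rights s (sInf {t | lefts s t = n})

/-- The branching process driven by the stacks `σ 0, σ 1, …` and started from `m`. -/
noncomputable def branching (σ : ℕ → ℕ → Bool) (m : ℕ) : ℕ → ℕ
  | 0 => m
  | k + 1 => rightsBefore (σ k) (branching σ m k)

lemma visits_zero (w : ℕ → ℤ) (z : ℤ) : visits w 0 z = 0 := by simp [visits]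

lemma visits_succ (w : ℕ → ℤ) (n : ℕ) (z : ℤ) :
    visits w (n + 1) z = visits w n z + if w n = z then 1 else 0 := by
  unfold visits
  rw [Finset.range_add_one, Finset.filter_insert]
  split_ifs <;> simp

lemma visits_le (w : ℕ → ℤ) (n : ℕ) (z : ℤ) : visits w n z ≤ n := by
  simpa [visits] using Finset.card_filter_le (Finset.range n) (fun i => w i = z)

lemma visits_mono (w : ℕ → ℤ) (z : ℤ) : Monotone (fun n => visits w n z) :=
  monotone_nat_of_le_succ fun n => by rw [visits_succ]; omega

@[simp] lemma rights_zero (s : ℕ → Bool) : rights s 0 = 0 := by simp [rights]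

@[simp] lemma lefts_zero (s : ℕ → Bool) : lefts s 0 = 0 := by simp [lefts]

lemma rights_succ (s : ℕ → Bool) (t : ℕ) :
    rights s (t + 1) = rights s t + if s t = true then 1 else 0 := by
  simp [rights, Nat.count_succ]

lemma lefts_succ (s : ℕ → Bool) (t : ℕ) :
    lefts s (t + 1) = lefts s t + if s t = false then 1 else 0 := by
  simp [lefts, Nat.count_succ]

lemma rights_add_lefts (s : ℕ → Bool) (t : ℕ) : rights s t + lefts s t = t := by
  induction t with
  | zero => simp
  | succ t ih =>
    rw [rights_succ, lefts_succ]
    cases s t <;> simp <;> omega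

lemma rights_mono (s : ℕ → Bool) : Monotone (rights s) := Nat.count_monotone _

lemma lefts_mono (s : ℕ → Bool) : Monotone (lefts s) := Nat.count_monotone _

lemma exists_count_eq {p : ℕ → Prop} [DecidablePred p] (h : ∃ᶠ i in atTop, p i) (n : ℕ) :
    ∃ t, Nat.count p t = n :=
  ⟨Nat.nth p n, Nat.count_nth_of_infinite (Nat.frequently_atTop_iff_infinite.1 h) n⟩

lemma GoodStack.exists_lefts_eq {s : ℕ → Bool} (h : GoodStack s) (n : ℕ) : ∃ t, lefts s t = n :=
  exists_count_eq h.2 n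

lemma GoodStack.exists_rights_eq {s : ℕ → Bool} (h : GoodStack s) (n : ℕ) :
    ∃ t, rights s t = n :=
  exists_count_eq h.1 n

lemma GoodStack.lefts_sInf {s : ℕ → Bool} (h : GoodStack s) (n : ℕ) :
    lefts s (sInf {t | lefts s t = n}) = n :=
  Nat.sInf_mem (s := {t | lefts s t = n}) (h.exists_lefts_eq n)

lemma rightsBefore_zero (s : ℕ → Bool) : rightsBefore s 0 = 0 := by
  have : sInf {t | lefts s t = 0} = 0 := Nat.sInf_eq_zero.2 (Or.inl (lefts_zero s))
  rw [rightsBefore, this, rights_zero]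

/-- A prefix with fewer than `n` left arrows ends before the `n`-th left arrow is reached. -/
lemma GoodStack.rights_le {s : ℕ → Bool} (h : GoodStack s) {t n : ℕ} (ht : lefts s t < n) :
    rights s t ≤ rightsBefore s n := by
  apply rights_mono
  by_contra! hlt
  have := lefts_mono s hlt.le
  rw [h.lefts_sInf] at this
  omega

/-- A prefix that ends with a left arrow, or is empty, is the shortest one with its number of left
arrows, hence the one selected by the infimum in `rightsBefore`. -/
lemma rightsBefore_eq {s : ℕ → Bool} {t : ℕ} (ht : 0 < t → s (t - 1) = false) :
    rightsBefore s (lefts s t) = rights s t := by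
  have : sInf {u | lefts s u = lefts s t} = t := by
    refine le_antisymm (Nat.sInf_le (s := {u | lefts s u = lefts s t}) rfl) ?_
    by_contra! hlt
    have hm : lefts s (sInf {u | lefts s u = lefts s t}) = lefts s t :=
      Nat.sInf_mem (s := {u | lefts s u = lefts s t}) ⟨t, rfl⟩
    obtain ⟨r, rfl⟩ : ∃ r, t = r + 1 := ⟨t - 1, by omega⟩
    have h1 := lefts_mono s (Nat.lt_succ_iff.1 hlt)
    have h2 := lefts_succ s r
    have h3 := ht (by omega)
    simp only [Nat.add_sub_cancel] at h3
    simp only [h3, if_true] at h2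
    omega
  rw [rightsBefore, this]

lemma branching_eq_zero_of_le {σ : ℕ → ℕ → Bool} {m k l : ℕ} (hkl : k ≤ l)
    (h : branching σ m k = 0) : branching σ m l = 0 := by
  induction l, hkl using Nat.le_induction with
  | base => exact h
  | succ l _ ih => rw [branching, ih, rightsBefore_zero]

lemma arrowSign_eq (b : Bool) : arrowSign b = 1 ∧ b = true ∨ arrowSign b = -1 ∧ b = false := by
  cases b <;> simp [arrowSign]

/-! ### Deterministic analysis of the walk: crossings, trichotomy, survival and extinction -/

namespace IsStackWalk

variable {η : ℤ → ℕ → Bool} {x : ℤ} {w : ℕ → ℤ}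

lemma abs_sub_le (hw : IsStackWalk η x w) (n : ℕ) : |w n - x| ≤ n := by
  induction n with
  | zero => simp [hw.start]
  | succ n ih =>
    rw [abs_le] at ih ⊢
    have := hw.step n
    push_cast
    rcases arrowSign_eq (η (w n) (visits w n (w n))) with h | h <;> constructor <;> omega

/-- The up-crossings and down-crossings of the edge between `z` and `z + 1` balance. -/
lemma crossing (hw : IsStackWalk η x w) (n : ℕ) (z : ℤ) :
    rights (η z) (visits w n z) + (if z < x then 1 else 0)
      = lefts (η (z + 1)) (visits w n (z + 1)) + if z < w n then 1 else 0 := by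
  induction n with
  | zero => simp [visits_zero, hw.start]
  | succ n ih =>
    have hs := hw.step n
    rw [visits_succ, visits_succ]
    by_cases h1 : w n = z
    · subst h1
      simp only [if_true, rights_succ, lt_irrefl, if_false, add_zero] at ih ⊢
      rw [if_neg (by omega : ¬ w n = w n + 1)]
      rcases arrowSign_eq (η (w n) (visits w n (w n))) with h | h
      · rw [if_pos h.2, if_pos (by omega : w n < w (n + 1))]
        simp only [add_zero]; omega
      · rw [if_neg (show ¬ η (w n) (visits w n (w n)) = true by simp [h.2]),
          if_neg (by omega : ¬ w n < w (n + 1))]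
        simp only [add_zero]; omega
    · by_cases h2 : w n = z + 1
      · rw [h2] at hs
        rw [if_neg h1, if_pos h2, lefts_succ]
        rw [if_pos (by omega : z < w n)] at ih
        simp only [add_zero]
        rcases arrowSign_eq (η (z + 1) (visits w n (z + 1))) with h | h
        · rw [if_neg (show ¬ η (z + 1) (visits w n (z + 1)) = false by simp [h.2]),
            if_pos (by omega : z < w (n + 1))]; omega
        · rw [if_pos h.2, if_neg (by omega : ¬ z < w (n + 1))]; omega
      · rw [if_neg h1, if_neg h2]
        have : z < w n ↔ z < w (n + 1) := by
          rcases arrowSign_eq (η (w n) (visits w n (w n))) with h | h <;> omega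
        simp only [this] at ih
        exact ih

/-- The last step from a site above the current position went to the left. -/
lemma last_left (hw : IsStackWalk η x w) (n : ℕ) (z : ℤ) (hz : w n < z) (hv : 0 < visits w n z) :
    η z (visits w n z - 1) = false := by
  induction n with
  | zero => simp [visits_zero] at hv
  | succ n ih =>
    have hs := hw.step n
    rw [visits_succ] at hv ⊢
    by_cases h1 : w n = z
    · subst h1
      rcases arrowSign_eq (η (w n) (visits w n (w n))) with h | h
      · omega
      · simpa using h.2
    · rw [if_neg h1] at hv ⊢
      refine ih ?_ hv
      rcases arrowSign_eq (η (w n) (visits w n (w n))) with h | h <;> omega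

lemma exists_visits_eq {w : ℕ → ℤ} {z : ℤ} (h : ∃ᶠ n in atTop, w n = z) (i : ℕ) :
    ∃ n, w n = z ∧ visits w n z = i := by
  have hinf := Nat.frequently_atTop_iff_infinite.1 h
  refine ⟨Nat.nth (fun n => w n = z) i, Nat.nth_mem_of_infinite hinf i, ?_⟩
  have := Nat.count_nth_of_infinite hinf i
  rwa [Nat.count_eq_card_filter_range] at this

/-- A site visited infinitely often uses up its whole stack; the arrow with index `i` is used no
earlier than time `i`, so late arrows produce late steps. -/
lemma frequently_step (hw : IsStackWalk η x w) {z : ℤ} (h : ∃ᶠ n in atTop, w n = z) (b : Bool)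
    (hb : ∃ᶠ i in atTop, η z i = b) : ∃ᶠ n in atTop, w n = z + arrowSign b := by
  rw [frequently_atTop] at hb ⊢
  intro N
  obtain ⟨i, hi, hib⟩ := hb N
  obtain ⟨n, hn, hv⟩ := exists_visits_eq h i
  refine ⟨n + 1, ?_, ?_⟩
  · have := visits_le w n z
    omega
  · rw [hw.step, hn, hv, hib]

lemma frequently_all (hw : IsStackWalk η x w) (hη : ∀ z, GoodStack (η z)) {z : ℤ}
    (h : ∃ᶠ n in atTop, w n = z) (y : ℤ) : ∃ᶠ n in atTop, w n = y := by
  induction y using Int.inductionOn' (b := z) with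
  | zero => exact h
  | succ k _ ih => exact hw.frequently_step ih true (hη k).1
  | pred k _ ih => exact hw.frequently_step ih false (hη k).2

/-- The path leaves every bounded set for good, and steps of size one cannot change sign without
hitting `0`. -/
lemma tendsto_of_eventually_ne (hw : IsStackWalk η x w) (h : ∀ z, ∀ᶠ n in atTop, w n ≠ z) :
    Tendsto w atTop atTop ∨ Tendsto w atTop atBot := by
  obtain ⟨N, hN⟩ := eventually_atTop.1 (h 0)
  have key : ∀ K : ℕ, ∀ᶠ n in atTop, (K : ℤ) < |w n| := by
    intro K
    have : ∀ᶠ n in atTop, ∀ z ∈ Finset.Icc (-(K : ℤ)) K, w n ≠ z :=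
      (eventually_all_finset _).2 fun z _ => h z
    filter_upwards [this] with n hn
    by_contra! hle
    exact hn (w n) (Finset.mem_Icc.2 (abs_le.1 hle)) rfl
  rcases lt_or_gt_of_ne (hN N le_rfl) with hneg | hpos
  · right
    have hall : ∀ n ≥ N, w n < 0 := fun n hn => by
      induction n, hn using Nat.le_induction with
      | base => exact hneg
      | succ n hn ih =>
        have hs := hw.step n
        have := hN (n + 1) (by omega)
        rcases arrowSign_eq (η (w n) (visits w n (w n))) with h | h <;> omega
    rw [tendsto_atBot]
    intro b
    filter_upwards [key b.natAbs, eventually_ge_atTop N] with n hn hnN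
    rw [abs_of_neg (hall n hnN)] at hn
    omega
  · left
    have hall : ∀ n ≥ N, 0 < w n := fun n hn => by
      induction n, hn using Nat.le_induction with
      | base => exact hpos
      | succ n hn ih =>
        have hs := hw.step n
        have := hN (n + 1) (by omega)
        rcases arrowSign_eq (η (w n) (visits w n (w n))) with h | h <;> omega
    rw [tendsto_atTop]
    intro b
    filter_upwards [key b.natAbs, eventually_ge_atTop N] with n hn hnN
    rw [abs_of_pos (hall n hnN)] at hn
    omega

/-- A stack walk visits its starting point infinitely often, or is transient to the right or to
the left. -/
lemma trichotomy (hw : IsStackWalk η x w) (hη : ∀ z, GoodStack (η z)) :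
    (∃ᶠ n in atTop, w n = x) ∨ Tendsto w atTop atTop ∨ Tendsto w atTop atBot := by
  by_cases h : ∃ᶠ n in atTop, w n = x
  · exact Or.inl h
  · refine Or.inr (hw.tendsto_of_eventually_ne fun z => ?_)
    by_contra hz
    exact h (hw.frequently_all hη (not_eventually.1 hz |>.mono fun _ hn => not_not.1 hn) x)

/-- If the walk is transient to the right, some branching process survives. -/
lemma exists_branching_pos (hw : IsStackWalk η x w) (hη : ∀ z, GoodStack (η z))
    (h : Tendsto w atTop atTop) :
    ∃ m, ∀ k, 0 < branching (fun k => η (x + 1 + k)) m k := by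
  obtain ⟨T₀, hT₀⟩ := eventually_atTop.1 (h.eventually_gt_atTop x)
  refine ⟨T₀, fun K => ?_⟩
  obtain ⟨T, hT⟩ := (h.eventually_gt_atTop (x + K)).exists
  -- From time `T₀` on the walk is to the right of `x`, so all its visits to `x` occur before `T₀`.
  have hvis : visits w T x ≤ T₀ := by
    have : visits w T x ≤ (Finset.range T₀).card := by
      refine Finset.card_le_card fun j hj => ?_
      rw [Finset.mem_filter] at hj
      by_contra hc
      rw [Finset.mem_range, not_lt] at hc
      exact (hT₀ j hc).ne' hj.2
    simpa using this
  have hcr : ∀ k ≤ K, rights (η (x + k)) (visits w T (x + k))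
      = lefts (η (x + k + 1)) (visits w T (x + k + 1)) + 1 := fun k hk => by
    have := hw.crossing T (x + k)
    rwa [if_neg (by omega), if_pos (by omega)] at this
  have hle : ∀ k ≤ K, rights (η (x + k)) (visits w T (x + k))
      ≤ branching (fun k => η (x + 1 + k)) T₀ k := fun k => by
    induction k with
    | zero =>
      intro _
      have := rights_add_lefts (η x) (visits w T x)
      simp only [branching, Nat.cast_zero, add_zero]
      omega
    | succ k ih =>
      intro hk
      have h1 := ih (by omega)
      have h2 := hcr k (by omega)
      have e : x + ((k + 1 : ℕ) : ℤ) = x + k + 1 := by push_cast; ring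
      have e' : x + 1 + (k : ℤ) = x + k + 1 := by ring
      rw [branching, e, e']
      -- At time `T` each edge up to `x + K` has one more up-crossing than down-crossings; this
      -- gives the strict inequality that `GoodStack.rights_le` needs.
      exact (hη _).rights_le (by omega)
  -- The unmatched up-crossing makes the right-arrow count at `x + K`, and so the branching process,
  -- positive.
  have h1 := hle K le_rfl
  have h2 := hcr K le_rfl
  omega

/-- If the walk is recurrent, every branching process dies out. -/
lemma exists_branching_eq_zero (hw : IsStackWalk η x w) (hη : ∀ z, GoodStack (η z))
    (h : ∃ᶠ n in atTop, w n = x) (m : ℕ) :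
    ∃ k, branching (fun k => η (x + 1 + k)) m k = 0 := by
  -- The walk is stopped at a visit to `x` before which exactly `m` right arrows at `x` were used.
  -- All crossings to the right are then balanced, and the counts of used right arrows form the
  -- branching process from `m`.
  obtain ⟨t, ht⟩ := (hη x).exists_rights_eq m
  obtain ⟨T, hT, hv⟩ := exists_visits_eq h t
  have hle : ∀ k : ℕ, rights (η (x + k)) (visits w T (x + k))
      = branching (fun k => η (x + 1 + k)) m k := fun k => by
    induction k with
    | zero => simp [branching, hv, ht]
    | succ k ih =>
      have hc := hw.crossing T (x + k)
      rw [if_neg (by omega), if_neg (by omega)] at hc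
      have e : x + ((k + 1 : ℕ) : ℤ) = x + k + 1 := by push_cast; ring
      have e' : x + 1 + (k : ℤ) = x + k + 1 := by ring
      rw [branching, e, e', ← ih]
      simp only [add_zero] at hc
      rw [hc, rightsBefore_eq]
      exact fun hpos => hw.last_left T _ (by omega) hpos
  -- Before time `T` the walk cannot have reached a site at distance `T + 1`.
  refine ⟨T + 1, ?_⟩
  rw [← hle]
  have : visits w T (x + ((T + 1 : ℕ) : ℤ)) = 0 := by
    rw [visits, Finset.card_eq_zero, Finset.filter_eq_empty_iff]
    intro j hj hc
    have h1 := hw.abs_sub_le j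
    rw [Finset.mem_range] at hj
    rw [hc, abs_le] at h1
    push_cast at h1
    omega
  rw [this, rights_zero]

end IsStackWalk

/-! ### Exploration of one random stack, arrow by arrow -/

/-- A function of the first `t` members of an independent sequence is independent of the next
member. -/
lemma iIndepFun.indepFun_of_dependsOn {Ω S T : Type*} [MeasurableSpace Ω] [MeasurableSpace S]
    [MeasurableSpace T] [Nonempty S] {μ : Measure Ω} {ξ : ℕ → Ω → S} (h : iIndepFun ξ μ)
    (hm : ∀ i, Measurable (ξ i)) {F : (ℕ → S) → T} (hF : Measurable F) (t : ℕ)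
    (hdep : ∀ s s' : ℕ → S, (∀ i < t, s i = s' i) → F s = F s') :
    IndepFun (fun ω => F fun i => ξ i ω) (ξ t) μ := by
  have hind := h.indepFun_finset (Finset.range t) {t} (by simp) hm
  -- The missing coordinates are filled with an arbitrary value, which `F` does not see.
  let c : S := Classical.arbitrary S
  let ext : ((Finset.range t) → S) → ℕ → S :=
    fun v i => if hi : i ∈ Finset.range t then v ⟨i, hi⟩ else c
  have hext : Measurable ext := by
    refine measurable_pi_iff.2 fun i => ?_
    by_cases hi : i ∈ Finset.range t
    · simp only [ext, hi, dite_true]; exact measurable_pi_apply _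
    · simp only [ext, hi, dite_false]; exact measurable_const
  have hev : Measurable fun v : ({t} : Finset ℕ) → S => v ⟨t, by simp⟩ := measurable_pi_apply _
  have := hind.comp (hF.comp hext) hev
  refine this.congr (ae_of_all _ fun ω => ?_) (ae_of_all _ fun ω => rfl)
  refine hdep _ _ fun i hi => ?_
  simp [ext, hi]

/-- One step of exploring a stack: the state records how many left arrows remain to be found and
how many right arrows have been found. -/
def stepState (b : Bool) : ℕ × ℕ → ℕ × ℕ
  | (0, y) => (0, y)
  | (k + 1, y) => if b then (k + 1, y + 1) else (k, y)

/-- The state after exploring `t` arrows of the stack `s` in search of `n` left arrows. -/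
def stackState (s : ℕ → Bool) (n : ℕ) : ℕ → ℕ × ℕ
  | 0 => (n, 0)
  | t + 1 => stepState (s t) (stackState s n t)

/-- The hypothesis says that no step before `t` starts from an absorbed state `(0, y)`, so the
exploration is a plain count. -/
lemma stackState_eq {s : ℕ → Bool} {n t : ℕ} (h : ∀ u < t, lefts s u < n) :
    stackState s n t = (n - lefts s t, rights s t) := by
  induction t with
  | zero => simp [stackState]
  | succ t ih =>
    have h1 := h t (by omega)
    obtain ⟨k, hk⟩ : ∃ k, n - lefts s t = k + 1 := ⟨n - lefts s t - 1, by omega⟩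
    rw [stackState, ih fun u hu => h u (by omega), hk, lefts_succ, rights_succ]
    cases hs : s t <;> simp [stepState] <;> omega

lemma GoodStack.eventually_stackState {s : ℕ → Bool} (hs : GoodStack s) (n : ℕ) :
    ∀ᶠ t in atTop, stackState s n t = (0, rightsBefore s n) := by
  set τ := sInf {t | lefts s t = n} with hτ
  have hl : lefts s τ = n := hs.lefts_sInf n
  rw [eventually_atTop]
  refine ⟨τ, fun t ht => ?_⟩
  induction t, ht using Nat.le_induction with
  | base =>
    rw [stackState_eq, hl, Nat.sub_self]
    · rfl
    · intro u hu
      refine lt_of_le_of_ne (hl ▸ lefts_mono s hu.le) fun he => ?_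
      exact (Nat.notMem_of_lt_sInf hu) he
  | succ t _ ih => rw [stackState, ih, stepState]

lemma stackState_congr {s s' : ℕ → Bool} {n t : ℕ} (h : ∀ i < t, s i = s' i) :
    stackState s n t = stackState s' n t := by
  induction t with
  | zero => rfl
  | succ t ih => rw [stackState, stackState, ih fun i hi => h i (by omega), h t (by omega)]

lemma measurable_stackState (n t : ℕ) : Measurable fun s : ℕ → Bool => stackState s n t := by
  induction t with
  | zero => exact measurable_const
  | succ t ih =>
    have : Measurable fun q : Bool × (ℕ × ℕ) => stepState q.1 q.2 := measurable_of_countable _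
    exact this.comp ((measurable_pi_apply t).prodMk ih)

lemma measurableSet_goodStack : MeasurableSet {s : ℕ → Bool | GoodStack s} := by
  have : ∀ b : Bool, MeasurableSet {s : ℕ → Bool | ∃ᶠ i in atTop, s i = b} := fun b => by
    have : {s : ℕ → Bool | ∃ᶠ i in atTop, s i = b}
        = ⋂ i, ⋃ j ∈ Set.Ici i, (fun s : ℕ → Bool => s j) ⁻¹' {b} := by
      ext s
      simp [frequently_atTop]
    rw [this]
    exact MeasurableSet.iInter fun i => MeasurableSet.biUnion (Set.to_countable _) fun j _ =>
      measurable_pi_apply j (measurableSet_singleton b)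
  exact (this true).inter (this false)

lemma measurable_rights (t : ℕ) : Measurable fun s : ℕ → Bool => rights s t := by
  induction t with
  | zero => simp
  | succ t ih =>
    simp only [rights_succ]
    exact ih.add ((measurable_of_countable fun b : Bool => if b = true then 1 else 0).comp
      (measurable_pi_apply t))

lemma measurable_lefts (t : ℕ) : Measurable fun s : ℕ → Bool => lefts s t := by
  have : (fun s : ℕ → Bool => lefts s t) = fun s => t - rights s t := by
    funext s
    have := rights_add_lefts s t
    omega
  rw [this]
  exact (measurable_of_countable fun k : ℕ => t - k).comp (measurable_rights t)

lemma measurable_rightsBefore (n : ℕ) : Measurable fun s : ℕ → Bool => rightsBefore s n := by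
  have h1 : Measurable fun s : ℕ → Bool => sInf {t | lefts s t = n} := by
    refine measurable_to_countable' fun k => ?_
    have hm : ∀ j, MeasurableSet ((fun s : ℕ → Bool => lefts s j) ⁻¹' {n}) := fun j =>
      measurable_lefts j (measurableSet_singleton n)
    -- The second member of the union covers stacks with too few left arrows, where the infimum of
    -- the empty set is `0`.
    have : (fun s : ℕ → Bool => sInf {t | lefts s t = n}) ⁻¹' {k}
        = ((fun s : ℕ → Bool => lefts s k) ⁻¹' {n}
            ∩ ⋂ j ∈ Set.Iio k, ((fun s : ℕ → Bool => lefts s j) ⁻¹' {n})ᶜ)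
          ∪ ((if k = 0 then Set.univ else ∅)
            ∩ ⋂ j, ((fun s : ℕ → Bool => lefts s j) ⁻¹' {n})ᶜ) := by
      ext s
      simp only [Set.mem_preimage, Set.mem_singleton_iff, Set.mem_union, Set.mem_inter_iff,
        Set.mem_iInter, Set.mem_compl_iff, Set.mem_Iio]
      constructor
      · rintro rfl
        by_cases he : ∃ j, lefts s j = n
        · exact Or.inl ⟨Nat.sInf_mem (s := {t | lefts s t = n}) he,
            fun j hj => Nat.notMem_of_lt_sInf (s := {t | lefts s t = n}) hj⟩
        · push Not at he
          have h0 : sInf {t | lefts s t = n} = 0 :=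
            Nat.sInf_eq_zero.2 (Or.inr (Set.eq_empty_of_forall_notMem he))
          exact Or.inr ⟨by simp [h0], he⟩
      · rintro (⟨h1, h2⟩ | ⟨h1, h2⟩)
        · refine le_antisymm (Nat.sInf_le (s := {t | lefts s t = n}) h1) ?_
          by_contra! hlt
          exact h2 _ hlt (Nat.sInf_mem (s := {t | lefts s t = n}) ⟨k, h1⟩)
        · have hk : k = 0 := by
            by_contra hk
            simp [hk] at h1
          rw [hk]
          exact Nat.sInf_eq_zero.2 (Or.inr (Set.eq_empty_of_forall_notMem h2))
    rw [this]
    refine MeasurableSet.union ((hm k).inter ?_) (MeasurableSet.inter ?_ ?_)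
    · exact MeasurableSet.biInter (Set.to_countable _) fun j _ => (hm j).compl
    · split_ifs <;> simp
    · exact MeasurableSet.iInter fun j => (hm j).compl
  have h2 : Measurable fun q : (ℕ → Bool) × ℕ => rights q.1 q.2 :=
    measurable_from_prod_countable_left fun t => measurable_rights t
  exact h2.comp (measurable_id.prodMk h1)

section Independent

variable {Ω : Type*} [MeasurableSpace Ω] {μ : Measure Ω}
  {s : ℕ → Ω → Bool}

/-- Second Borel–Cantelli lemma: the fair arrows alone make the sum of probabilities diverge. -/
lemma ae_frequently_eq (hind : iIndepFun s μ) (hm : ∀ i, Measurable (s i)) {M : ℕ} (b : Bool)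
    (hfair : ∀ i, M ≤ i → μ {ω | s i ω = b} = 2⁻¹) : ∀ᵐ ω ∂μ, ∃ᶠ i in atTop, s i ω = b := by
  have hmeas : ∀ i, MeasurableSet {ω | s i ω = b} := fun i => hm i (measurableSet_singleton b)
  have hI : iIndepSet (fun i => {ω | s i ω = b}) μ := by
    rw [iIndepSet_iff_meas_biInter hmeas]
    intro S
    exact hind.meas_biInter fun i _ => ⟨{b}, measurableSet_singleton b, rfl⟩
  have hsum : ∑' i, μ {ω | s i ω = b} = ∞ := by
    rw [← top_le_iff]
    calc (⊤ : ℝ≥0∞) = ∑' _ : ℕ, (2⁻¹ : ℝ≥0∞) := (ENNReal.tsum_const_eq_top_of_ne_zero (by simp)).symm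
      _ = ∑' i : ℕ, μ {ω | s (i + M) ω = b} := by
        refine tsum_congr fun i => ?_
        rw [hfair (i + M) (by omega)]
      _ ≤ ∑' i, μ {ω | s i ω = b} :=
        ENNReal.tsum_comp_le_tsum_of_injective (add_left_injective M) fun i => μ {ω | s i ω = b}
  have := hind.isProbabilityMeasure
  have hlim := measure_limsup_eq_one hmeas hI hsum
  have := (mem_ae_iff_prob_eq_one (MeasurableSet.measurableSet_limsup hmeas)).2 hlim
  filter_upwards [this] with ω hω
  rwa [mem_limsup_iff_frequently_mem] at hω

lemma ae_goodStack (hind : iIndepFun s μ) (hm : ∀ i, Measurable (s i)) {M : ℕ}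
    (hfair : ∀ b, ∀ i, M ≤ i → μ {ω | s i ω = b} = 2⁻¹) : ∀ᵐ ω ∂μ, GoodStack fun i => s i ω := by
  filter_upwards [ae_frequently_eq hind hm true (hfair true),
    ae_frequently_eq hind hm false (hfair false)] with ω h1 h2
  exact ⟨h1, h2⟩

/-- Exploring one fair arrow does not increase the expectation of a supersolution. -/
lemma lintegral_stackState_succ_le (hind : iIndepFun s μ) (hm : ∀ i, Measurable (s i)) {t : ℕ}
    (hfair : ∀ b, μ {ω | s t ω = b} = 2⁻¹) {B : ℕ × ℕ → ℝ≥0∞}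
    (hB : ∀ k y, 2⁻¹ * B (k + 1, y + 1) + 2⁻¹ * B (k, y) ≤ B (k + 1, y)) (n : ℕ) :
    ∫⁻ ω, B (stackState (fun i => s i ω) n (t + 1)) ∂μ
      ≤ ∫⁻ ω, B (stackState (fun i => s i ω) n t) ∂μ := by
  have hmst : Measurable fun ω => stackState (fun i => s i ω) n t :=
    (measurable_stackState n t).comp (measurable_pi_iff.2 hm)
  have hI : IndepFun (fun ω => stackState (fun i => s i ω) n t) (s t) μ :=
    iIndepFun.indepFun_of_dependsOn hind hm (measurable_stackState n t) t
      fun _ _ h => stackState_congr h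
  have key : ∀ b, ∫⁻ ω, B (stepState b (stackState (fun i => s i ω) n t))
      * (if s t ω = b then 1 else 0) ∂μ
      = ∫⁻ ω, 2⁻¹ * B (stepState b (stackState (fun i => s i ω) n t)) ∂μ := fun b => by
    have hb : Measurable fun c : Bool => if c = b then (1 : ℝ≥0∞) else 0 := measurable_of_countable _
    have hg : Measurable fun v : ℕ × ℕ => B (stepState b v) := measurable_of_countable _
    have h1 := lintegral_mul_eq_lintegral_mul_lintegral_of_indepFun (hg.comp hmst)
      (hb.comp (hm t)) (hI.comp hg hb)
    have h2 : ∫⁻ ω, (if s t ω = b then (1 : ℝ≥0∞) else 0) ∂μ = 2⁻¹ := by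
      have hset : MeasurableSet {ω | s t ω = b} := hm t (measurableSet_singleton b)
      rw [← hfair b, ← lintegral_indicator_one hset]
      refine lintegral_congr fun ω => ?_
      simp [Set.indicator_apply]
    simp only [Pi.mul_apply, Function.comp_apply] at h1
    rw [h1, h2, mul_comm]
    exact (lintegral_const_mul _ (hg.comp hmst)).symm
  have hms : ∀ b, Measurable fun ω => 2⁻¹ * B (stepState b (stackState (fun i => s i ω) n t)) :=
    fun b => (measurable_of_countable fun v : ℕ × ℕ => 2⁻¹ * B (stepState b v)).comp hmst
  have hms' : Measurable fun ω => B (stepState true (stackState (fun i => s i ω) n t))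
      * (if s t ω = true then 1 else 0) :=
    (measurable_of_countable fun q : (ℕ × ℕ) × Bool =>
      B (stepState true q.1) * (if q.2 = true then 1 else 0)).comp (hmst.prodMk (hm t))
  calc ∫⁻ ω, B (stackState (fun i => s i ω) n (t + 1)) ∂μ
      = ∫⁻ ω, (B (stepState true (stackState (fun i => s i ω) n t))
          * (if s t ω = true then 1 else 0)
        + B (stepState false (stackState (fun i => s i ω) n t))
          * (if s t ω = false then 1 else 0)) ∂μ := by
        refine lintegral_congr fun ω => ?_
        rw [stackState]
        cases s t ω <;> simp
    _ = ∫⁻ ω, (2⁻¹ * B (stepState true (stackState (fun i => s i ω) n t))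
        + 2⁻¹ * B (stepState false (stackState (fun i => s i ω) n t))) ∂μ := by
        rw [lintegral_add_left hms', key, key, lintegral_add_left (hms true)]
    _ ≤ _ := by
        refine lintegral_mono fun ω => ?_
        obtain ⟨k, y⟩ := stackState (fun i => s i ω) n t
        cases k with
        | zero =>
          simp only [stepState]
          rw [← add_mul, ENNReal.inv_two_add_inv_two, one_mul]
        | succ k => simpa [stepState] using hB k y

/-- After the first `M` arrows the exploration is fair, so the expectation of `B` no longer
increases. The state is almost surely absorbed at `(0, rightsBefore s n)`, and Fatou's lemma passes
to that limit. -/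
lemma lintegral_rightsBefore_le (hind : iIndepFun s μ) (hm : ∀ i, Measurable (s i)) {M : ℕ}
    (hfair : ∀ b, ∀ i, M ≤ i → μ {ω | s i ω = b} = 2⁻¹) {B : ℕ × ℕ → ℝ≥0∞}
    (hB : ∀ k y, 2⁻¹ * B (k + 1, y + 1) + 2⁻¹ * B (k, y) ≤ B (k + 1, y)) (n : ℕ) :
    ∫⁻ ω, B (0, rightsBefore (fun i => s i ω) n) ∂μ
      ≤ ∫⁻ ω, B (stackState (fun i => s i ω) n M) ∂μ := by
  have hanti : ∀ t ≥ M, ∫⁻ ω, B (stackState (fun i => s i ω) n t) ∂μ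
      ≤ ∫⁻ ω, B (stackState (fun i => s i ω) n M) ∂μ := fun t ht => by
    induction t, ht using Nat.le_induction with
    | base => exact le_rfl
    | succ t ht ih =>
      exact (lintegral_stackState_succ_le hind hm (fun b => hfair b t ht) hB n).trans ih
  calc ∫⁻ ω, B (0, rightsBefore (fun i => s i ω) n) ∂μ
      = ∫⁻ ω, liminf (fun t => B (stackState (fun i => s i ω) n t)) atTop ∂μ := by
        refine lintegral_congr_ae ?_
        filter_upwards [ae_goodStack hind hm hfair] with ω hω
        have h1 : Tendsto (fun t => B (stackState (fun i => s i ω) n t)) atTop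
            (nhds (B (0, rightsBefore (fun i => s i ω) n))) :=
          tendsto_const_nhds.congr' ((hω.eventually_stackState n).mono fun t ht => by
            simp only [ht])
        exact h1.liminf_eq.symm
    _ ≤ liminf (fun t => ∫⁻ ω, B (stackState (fun i => s i ω) n t) ∂μ) atTop :=
        lintegral_liminf_le fun t => (measurable_of_countable B).comp
          ((measurable_stackState n t).comp (measurable_pi_iff.2 hm))
    _ ≤ _ := by
        refine liminf_le_of_frequently_le' (Eventually.frequently ?_)
        exact eventually_atTop.2 ⟨M, hanti⟩

end Independent

/-! ### Maximum principle with a Lyapunov function -/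

section MaximumPrinciple

variable {α : Type*} [MeasurableSpace α] {ν : Measure α} [IsProbabilityMeasure ν]

/-- A maximum that is at most the mean over its successors is attained at almost every successor, in
particular at `0`. -/
lemma eq_of_le_integral_of_forall_le {u : ℕ → ℝ} {φ : α → ℕ} {n : ℕ} (hmax : ∀ k, u k ≤ u n)
    (hint : Integrable (fun s => u (φ s)) ν) (hsub : u n ≤ ∫ s, u (φ s) ∂ν)
    (hpos : 0 < ν {s | φ s = 0}) : u 0 = u n := by
  have h0 : ∫ s, (u n - u (φ s)) ∂ν = 0 := by
    refine le_antisymm ?_ (integral_nonneg fun s => sub_nonneg.2 (hmax _))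
    rw [integral_sub (integrable_const _) hint]
    simpa using hsub
  rw [integral_eq_zero_iff_of_nonneg (fun s => sub_nonneg.2 (hmax _))
    ((integrable_const _).sub hint)] at h0
  have hfr : ∃ᵐ s ∂ν, φ s = 0 := frequently_ae_iff.2 hpos.ne'
  obtain ⟨s, hs, hs'⟩ := (hfr.and_eventually h0).exists
  have : u n - u (φ s) = 0 := hs'
  rw [hs] at this
  linarith

/-- A bounded subharmonic function vanishing at the absorbing state `0` vanishes identically if
there is a Lyapunov function. -/
lemma nonpos_of_lyapunov {φ : ℕ → α → ℕ} (hφ : ∀ n, Measurable (φ n))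
    (hpos : ∀ n, 0 < ν {s | φ n s = 0}) {h : ℕ → ℝ} (h_nonneg : ∀ n, 0 ≤ h n) (h_le : ∀ n, h n ≤ 1)
    (h_zero : h 0 = 0) (hsub : ∀ n, h n ≤ ∫ s, h (φ n s) ∂ν) {L : ℕ → ℝ} (hL : ∀ n, 0 ≤ L n)
    (hLtop : Tendsto L atTop atTop) {N : ℕ}
    (hLint : ∀ n ≥ N, Integrable (fun s => L (φ n s)) ν)
    (hLsup : ∀ n ≥ N, ∫ s, L (φ n s) ∂ν ≤ L n) (n : ℕ) : h n ≤ 0 := by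
  have hint : ∀ n, Integrable (fun s => h (φ n s)) ν := fun n =>
    Integrable.of_bound ((measurable_of_countable h).comp (hφ n)).aestronglyMeasurable 1
      (ae_of_all _ fun s => by
        rw [Real.norm_of_nonneg (h_nonneg _)]
        exact h_le _)
  obtain ⟨j, -, hj⟩ := (Finset.range (N + 1)).exists_max_image h ⟨0, by simp⟩
  -- Subtracting `ε * L` forces a maximum to exist. Beyond `N` the difference is subharmonic, so a
  -- maximum there is also attained at `0`; otherwise the maximum lies in the finite range where `h`
  -- is at most `h j`. Letting `ε` tend to `0` makes `j` a global maximum of `h`.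
  have key : ∀ ε > 0, ∀ n, h n ≤ ε * L n + h j := by
    intro ε hε n
    have hbot : Tendsto (fun n => h n - ε * L n) cofinite atBot := by
      rw [Nat.cofinite_eq_atTop]
      have h1 : Tendsto (fun n => 1 - ε * L n) atTop atBot :=
        tendsto_atBot_add_const_left _ 1 (tendsto_neg_atTop_atBot.comp
          (hLtop.const_mul_atTop hε))
      exact tendsto_atBot_mono (fun n => by linarith [h_le n]) h1
    obtain ⟨a, ha⟩ := hbot.exists_forall_ge
    have hn := ha n
    rcases le_or_gt a N with haN | haN
    · have h1 := hj a (by simpa [Nat.lt_succ_iff] using haN)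
      have h2 := mul_nonneg hε.le (hL a)
      linarith
    · have hsub' : h a - ε * L a ≤ ∫ s, (h (φ a s) - ε * L (φ a s)) ∂ν := by
        rw [integral_sub (hint a) ((hLint a haN.le).const_mul ε), integral_const_mul]
        have := mul_le_mul_of_nonneg_left (hLsup a haN.le) hε.le
        linarith [hsub a]
      have h0 := eq_of_le_integral_of_forall_le (u := fun n => h n - ε * L n) ha
        ((hint a).sub ((hLint a haN.le).const_mul ε)) hsub' (hpos a)
      simp only [h_zero] at h0
      have h2 := mul_nonneg hε.le (hL 0)
      linarith [h_nonneg j]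
  have hmax : ∀ n, h n ≤ h j := fun n => by
    have ht : Tendsto (fun ε : ℝ => ε * L n + h j) (nhdsWithin 0 (Set.Ioi 0)) (nhds (0 * L n + h j)) :=
      (((continuous_id.mul continuous_const).add continuous_const).tendsto 0).mono_left
        nhdsWithin_le_nhds
    have := ge_of_tendsto ht (eventually_nhdsWithin_of_forall fun ε hε => key ε hε n)
    simpa using this
  have := eq_of_le_integral_of_forall_le hmax (hint j) (hsub j) (hpos j)
  linarith [hmax n]

end MaximumPrinciple

/-! ### The branching chain: extinction bounds from supersolutions and Lyapunov functions -/

/-- The transition operator of the branching process with stack law `ν`. -/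
noncomputable def branchingOp (ν : Measure (ℕ → Bool)) (g : ℕ → ℝ≥0∞) (n : ℕ) : ℝ≥0∞ :=
  ∫⁻ s, g (rightsBefore s n) ∂ν

lemma branchingOp_mono (ν : Measure (ℕ → Bool)) : Monotone (branchingOp ν) :=
  fun _ _ h _ => lintegral_mono fun _ => h _

lemma branching_congr {σ σ' : ℕ → ℕ → Bool} {m k : ℕ} (h : ∀ i < k, σ i = σ' i) :
    branching σ m k = branching σ' m k := by
  induction k with
  | zero => rfl
  | succ k ih => rw [branching, branching, ih fun i hi => h i (by omega), h k (by omega)]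

lemma measurable_rightsBefore_uncurry :
    Measurable fun q : (ℕ → Bool) × ℕ => rightsBefore q.1 q.2 :=
  measurable_from_prod_countable_left measurable_rightsBefore

lemma measurable_branching (m k : ℕ) : Measurable fun σ : ℕ → ℕ → Bool => branching σ m k := by
  induction k with
  | zero => exact measurable_const
  | succ k ih => exact measurable_rightsBefore_uncurry.comp ((measurable_pi_apply k).prodMk ih)

section Chain

variable {Ω : Type*} [MeasurableSpace Ω] {μ : Measure Ω} [IsProbabilityMeasure μ]
  {σ : ℕ → Ω → ℕ → Bool} {ν : Measure (ℕ → Bool)} [IsProbabilityMeasure ν]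

/-- Integrating out the newest stack, which is independent of the present state, replaces `g` by
`branchingOp ν g`; hence the induction over all `g`. -/
lemma lintegral_branching (hind : iIndepFun σ μ) (hm : ∀ k, Measurable (σ k))
    (hν : ∀ k, μ.map (σ k) = ν) (m k : ℕ) (g : ℕ → ℝ≥0∞) :
    ∫⁻ ω, g (branching (fun k => σ k ω) m k) ∂μ = (branchingOp ν)^[k] g m := by
  induction k generalizing g with
  | zero => simp [branching]
  | succ k ih =>
    have hV : Measurable fun ω => branching (fun k => σ k ω) m k :=
      (measurable_branching m k).comp (measurable_pi_iff.2 hm)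
    have hI : IndepFun (fun ω => branching (fun k => σ k ω) m k) (σ k) μ :=
      iIndepFun.indepFun_of_dependsOn hind hm (measurable_branching m k) k
        fun _ _ h => branching_congr h
    have hlaw := (indepFun_iff_map_prod_eq_prod_map_map hV.aemeasurable (hm k).aemeasurable).1 hI
    have hG : Measurable fun q : ℕ × (ℕ → Bool) => g (rightsBefore q.2 q.1) :=
      (measurable_of_countable g).comp (measurable_rightsBefore_uncurry.comp measurable_swap)
    have : IsProbabilityMeasure (μ.map fun ω => branching (fun k => σ k ω) m k) :=
      Measure.isProbabilityMeasure_map hV.aemeasurable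
    rw [Function.iterate_succ_apply, ← ih]
    calc ∫⁻ ω, g (branching (fun k => σ k ω) m (k + 1)) ∂μ
        = ∫⁻ q, g (rightsBefore q.2 q.1)
            ∂(μ.map fun ω => (branching (fun k => σ k ω) m k, σ k ω)) := by
          rw [lintegral_map hG (hV.prodMk (hm k))]
          rfl
      _ = ∫⁻ v, branchingOp ν g v ∂(μ.map fun ω => branching (fun k => σ k ω) m k) := by
          rw [hlaw, hν, lintegral_prod _ hG.aemeasurable]
          rfl
      _ = _ := lintegral_map (measurable_of_countable _) hV

/-- A supersolution bounds the extinction probability. -/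
lemma measure_exists_branching_eq_zero_le (hind : iIndepFun σ μ) (hm : ∀ k, Measurable (σ k))
    (hν : ∀ k, μ.map (σ k) = ν) {g : ℕ → ℝ≥0∞} (hg0 : 1 ≤ g 0) (hg : branchingOp ν g ≤ g)
    (m : ℕ) : μ {ω | ∃ k, branching (fun k => σ k ω) m k = 0} ≤ g m := by
  have hmono : Monotone fun k => {ω | branching (fun k => σ k ω) m k = 0} :=
    fun k l hkl ω hω => branching_eq_zero_of_le hkl hω
  have hiter : ∀ k, (branchingOp ν)^[k] g ≤ g := fun k => by
    induction k with
    | zero => exact le_rfl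
    | succ k ih =>
      rw [Function.iterate_succ_apply']
      exact (branchingOp_mono ν ih).trans hg
  have hU : {ω | ∃ k, branching (fun k => σ k ω) m k = 0}
      = ⋃ k, {ω | branching (fun k => σ k ω) m k = 0} := by
    ext ω
    simp
  rw [hU, hmono.measure_iUnion]
  refine iSup_le fun k => ?_
  have hset : MeasurableSet {ω | branching (fun k => σ k ω) m k = 0} :=
    ((measurable_branching m k).comp (measurable_pi_iff.2 hm)) (measurableSet_singleton 0)
  calc μ {ω | branching (fun k => σ k ω) m k = 0}
      = ∫⁻ ω, {ω | branching (fun k => σ k ω) m k = 0}.indicator 1 ω ∂μ :=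
        (lintegral_indicator_one hset).symm
    _ ≤ ∫⁻ ω, g (branching (fun k => σ k ω) m k) ∂μ := by
        refine lintegral_mono fun ω => ?_
        by_cases h0 : branching (fun k => σ k ω) m k = 0
        · rw [Set.indicator_of_mem (by exact h0), h0]
          exact hg0
        · rw [Set.indicator_of_notMem (by exact h0)]
          exact zero_le
    _ = (branchingOp ν)^[k] g m := lintegral_branching hind hm hν m k g
    _ ≤ g m := hiter k m

/-- If there is a Lyapunov function, the branching process dies out almost surely. -/
lemma ae_exists_branching_eq_zero (hind : iIndepFun σ μ) (hm : ∀ k, Measurable (σ k))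
    (hν : ∀ k, μ.map (σ k) = ν) (hpos : ∀ n, 0 < ν {s | rightsBefore s n = 0})
    {L : ℕ → ℝ} (hL : ∀ n, 0 ≤ L n) (hLtop : Tendsto L atTop atTop) {N : ℕ}
    (hLsup : ∀ n ≥ N, branchingOp ν (fun k => ENNReal.ofReal (L k)) n ≤ ENNReal.ofReal (L n))
    (m : ℕ) : ∀ᵐ ω ∂μ, ∃ k, branching (fun k => σ k ω) m k = 0 := by
  -- The iterates `hk k` of this indicator are the probabilities of being alive at generation `k`.
  -- Their decreasing limit `H`, the survival probability, is subharmonic by monotone convergence,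
  -- so the maximum principle applies to it.
  let p : ℕ → ℝ≥0∞ := fun n => if n = 0 then 0 else 1
  let hk : ℕ → ℕ → ℝ≥0∞ := fun k => (branchingOp ν)^[k] p
  have hp1 : branchingOp ν p ≤ p := fun n => by
    rcases Nat.eq_zero_or_pos n with rfl | hn
    · simp [branchingOp, rightsBefore_zero, p]
    · have : p n = 1 := by simp [p, hn.ne']
      rw [this]
      calc branchingOp ν p n ≤ ∫⁻ _, 1 ∂ν := lintegral_mono fun s => by
            simp only [p]
            split_ifs <;> simp
        _ = 1 := by simp
  have hanti : Antitone hk := antitone_nat_of_succ_le fun k => by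
    simp only [hk, Function.iterate_succ_apply]
    exact (branchingOp_mono ν).iterate k hp1
  have hk_le : ∀ k n, hk k n ≤ 1 := fun k n => by
    refine (hanti (Nat.zero_le k) n).trans ?_
    simp only [hk, Function.iterate_zero, id, p]
    split_ifs <;> simp
  let H : ℕ → ℝ≥0∞ := fun n => ⨅ k, hk k n
  have hH_le : ∀ n, H n ≤ 1 := fun n => (iInf_le _ 0).trans (hk_le 0 n)
  have hfin : ∀ n, H n ≠ ∞ := fun n => ((hH_le n).trans_lt ENNReal.one_lt_top).ne
  have hH : ∀ n, H n ≤ ∫⁻ s, H (rightsBefore s n) ∂ν := fun n => by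
    simp only [H]
    rw [lintegral_iInf (f := fun k s => hk k (rightsBefore s n))
      (fun k => (measurable_of_countable (hk k)).comp (measurable_rightsBefore n))
      (fun _ _ h s => hanti h _)]
    · refine le_iInf fun k => (iInf_le _ (k + 1)).trans_eq ?_
      simp only [hk, Function.iterate_succ_apply']
      rfl
    · refine ((lintegral_mono fun s => hk_le 0 _).trans_lt ?_).ne
      simp
  have hmeasH : ∀ n, Measurable fun s => H (rightsBefore s n) := fun n =>
    (measurable_of_countable H).comp (measurable_rightsBefore n)
  have hmeasL : ∀ n, Measurable fun s => L (rightsBefore s n) := fun n =>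
    (measurable_of_countable L).comp (measurable_rightsBefore n)
  have hLint : ∀ n ≥ N, Integrable (fun s => L (rightsBefore s n)) ν := fun n hn => by
    refine ⟨(hmeasL n).aestronglyMeasurable, ?_⟩
    rw [hasFiniteIntegral_iff_ofReal (ae_of_all _ fun s => hL _)]
    exact (hLsup n hn).trans_lt ENNReal.ofReal_lt_top
  have hzero := nonpos_of_lyapunov (φ := fun n s => rightsBefore s n) (h := fun n => (H n).toReal)
    measurable_rightsBefore hpos (fun n => ENNReal.toReal_nonneg)
    (fun n => by simpa using ENNReal.toReal_mono ENNReal.one_ne_top (hH_le n))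
    (by
      have : H 0 ≤ 0 := (iInf_le _ 0).trans (by simp [hk, p])
      simp [le_antisymm this zero_le])
    (fun n => by
      rw [integral_toReal (hmeasH n).aemeasurable
        (ae_of_all _ fun s => (hH_le _).trans_lt ENNReal.one_lt_top)]
      refine ENNReal.toReal_mono (ne_top_of_le_ne_top ENNReal.one_ne_top ?_) (hH n)
      calc ∫⁻ s, H (rightsBefore s n) ∂ν ≤ ∫⁻ _, 1 ∂ν := lintegral_mono fun s => hH_le _
        _ = 1 := by simp)
    hL hLtop hLint
    (fun n hn => by
      rw [integral_eq_lintegral_of_nonneg_ae (ae_of_all _ fun s => hL _)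
        (hmeasL n).aestronglyMeasurable]
      exact ENNReal.toReal_le_of_le_ofReal (hL n) (hLsup n hn))
    m
  have hHm : H m = 0 := by
    have := le_antisymm hzero ENNReal.toReal_nonneg
    exact ((ENNReal.toReal_eq_zero_iff _).1 this).resolve_right (hfin m)
  rw [ae_iff, ← le_zero_iff, ← hHm]
  refine le_iInf fun k => ?_
  have hset : MeasurableSet {ω | branching (fun k => σ k ω) m k ≠ 0} :=
    ((measurable_branching m k).comp (measurable_pi_iff.2 hm)) (measurableSet_singleton 0).compl
  calc μ {ω | ¬ ∃ k, branching (fun k => σ k ω) m k = 0}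
      ≤ μ {ω | branching (fun k => σ k ω) m k ≠ 0} :=
        measure_mono fun ω hω h0 => hω ⟨k, h0⟩
    _ = ∫⁻ ω, {ω | branching (fun k => σ k ω) m k ≠ 0}.indicator 1 ω ∂μ :=
        (lintegral_indicator_one hset).symm
    _ = ∫⁻ ω, p (branching (fun k => σ k ω) m k) ∂μ := by
        refine lintegral_congr fun ω => ?_
        simp only [Set.indicator_apply, p, Pi.one_apply]
        by_cases h0 : branching (fun k => σ k ω) m k = 0 <;> simp [h0]
    _ = hk k m := lintegral_branching hind hm hν m k p

end Chain

/-! ### The logarithmic Lyapunov function for drift below one -/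

/-- The logarithmic supersolution of the exploration of fair stacks. -/
noncomputable def logSup (v : ℕ × ℕ) : ℝ :=
  Real.log (v.1 + v.2 + 3) - v.1 / (v.1 + v.2 + 4) ^ 2

lemma logSup_nonneg (v : ℕ × ℕ) : 0 ≤ logSup v := by
  obtain ⟨k, y⟩ := v
  simp only [logSup]
  have hk : (0 : ℝ) ≤ k := k.cast_nonneg
  have hy : (0 : ℝ) ≤ y := y.cast_nonneg
  have h1 : 1 ≤ Real.log (k + y + 3) := by
    rw [Real.le_log_iff_exp_le (by positivity)]
    linarith [Real.exp_one_lt_three]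
  have h2 : (k : ℝ) / (k + y + 4) ^ 2 ≤ 1 := by
    rw [div_le_one (by positivity)]
    nlinarith
  linarith

/-- Midpoint convexity of the inverse square. -/
lemma two_div_sq_le {x : ℝ} (hx : 0 < x) :
    2 / (x + 1) ^ 2 ≤ 1 / (x + 2) ^ 2 + 1 / x ^ 2 := by
  rw [div_add_div _ _ (by positivity) (by positivity), div_le_div_iff₀ (by positivity)
    (by positivity)]
  have : 0 ≤ 6 * x ^ 2 + 12 * x + 4 := by positivity
  nlinarith

/-- With `z = k + y + 4`, concavity of the logarithm yields a gain of `1 / z ^ 2`, and the drop from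
`k + 1` to `k` in the correction term costs exactly as much. The shifts `3` and `4` in `logSup`
differ by one so that both terms have the same denominator; the rest is convexity. -/
lemma logSup_super (k y : ℕ) : logSup (k + 1, y + 1) + logSup (k, y) ≤ 2 * logSup (k + 1, y) := by
  simp only [logSup]
  push_cast
  obtain ⟨z, hz⟩ : ∃ z : ℝ, z = k + 1 + y + 3 := ⟨_, rfl⟩
  have hk : (0 : ℝ) ≤ k := k.cast_nonneg
  have hy : (0 : ℝ) ≤ y := y.cast_nonneg
  have hz4 : 4 ≤ z := by linarith
  have e1 : (k : ℝ) + 1 + (y + 1) + 3 = z + 1 := by rw [hz]; ring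
  have e2 : (k : ℝ) + 1 + (y + 1) + 4 = z + 2 := by rw [hz]; ring
  have e3 : (k : ℝ) + y + 3 = z - 1 := by rw [hz]; ring
  have e4 : (k : ℝ) + y + 4 = z := by rw [hz]; ring
  have e5 : (k : ℝ) + 1 + y + 4 = z + 1 := by rw [hz]; ring
  rw [e1, e2, e3, e4, ← hz, e5]
  have hlog : Real.log (z + 1) + Real.log (z - 1) ≤ 2 * Real.log z - 1 / z ^ 2 := by
    rw [← Real.log_mul (by linarith) (by linarith)]
    have h1 : (z + 1) * (z - 1) = z ^ 2 * (1 - 1 / z ^ 2) := by field_simp; ring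
    have h2 : 1 / z ^ 2 < 1 := by
      rw [div_lt_one (by positivity)]
      nlinarith
    rw [h1, Real.log_mul (by positivity) (by linarith), Real.log_pow]
    have h3 := Real.log_le_sub_one_of_pos (show 0 < 1 - 1 / z ^ 2 by linarith)
    push_cast
    linarith
  have h2 := mul_le_mul_of_nonneg_left (two_div_sq_le (show 0 < z by linarith))
    (show (0 : ℝ) ≤ k + 1 by linarith)
  have i1 : ((k : ℝ) + 1) * (2 / (z + 1) ^ 2) = 2 * ((k + 1) / (z + 1) ^ 2) := by ring
  have i2 : ((k : ℝ) + 1) * (1 / (z + 2) ^ 2 + 1 / z ^ 2)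
      = (k + 1) / (z + 2) ^ 2 + k / z ^ 2 + 1 / z ^ 2 := by ring
  rw [i1, i2] at h2
  linarith

/-- The drift of the logarithm is negative far away from the origin if `δ < 1`. -/
lemma exists_logSup_drift {δ : ℝ} (hδ : δ < 1) (M : ℕ) : ∃ N : ℕ, M ≤ N ∧ ∀ n ≥ N, ∃ c₀ c₁ : ℝ,
    (∀ r ≤ M, logSup (n - (M - r), r) ≤ c₀ + c₁ * (2 * r - M)) ∧
      c₀ + c₁ * δ ≤ logSup (0, n) := by
  -- This expression is `n + 3` times `c₀ + c₁ * δ - logSup (0, n)` for the constants chosen below;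
  -- its limit is `δ - 1`.
  have hlim : Tendsto (fun n : ℕ => δ - (1 - (M + 3 : ℝ) / (n + 3)) / (1 + (M + 1 : ℝ) / (n + 3)) ^ 2)
      atTop (nhds (δ - (1 - 0) / (1 + 0) ^ 2)) := by
    have h1 : ∀ C : ℝ, Tendsto (fun n : ℕ => C / ((n : ℝ) + 3)) atTop (nhds 0) := fun C =>
      Tendsto.div_atTop tendsto_const_nhds
        (tendsto_atTop_add_const_right _ 3 tendsto_natCast_atTop_atTop)
    refine tendsto_const_nhds.sub (Tendsto.div (tendsto_const_nhds.sub (h1 _))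
      ((tendsto_const_nhds.add (h1 _)).pow 2) (by norm_num))
  have hev := hlim.eventually (gt_mem_nhds (show δ - (1 - 0) / (1 + 0) ^ 2 < 0 by norm_num; linarith))
  obtain ⟨N, hN⟩ := eventually_atTop.1 hev
  refine ⟨max N M, le_max_right _ _, fun n hn => ?_⟩
  have hnM : M ≤ n := (le_max_right _ _).trans hn
  have hn0 := hN n ((le_max_left _ _).trans hn)
  have hn' : (M : ℝ) ≤ n := by exact_mod_cast hnM
  have hM0 : (0 : ℝ) ≤ M := M.cast_nonneg
  have hpos : (0 : ℝ) < n + 3 := by linarith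
  -- The tangent to the logarithm at `n + 3`, with the correction term bounded by its smallest
  -- numerator (`r = 0`) and its largest denominator (`r = M`).
  refine ⟨Real.log (n + 3) - (n - M) / (n + M + 4) ^ 2, 1 / (n + 3), fun r hr => ?_, ?_⟩
  · have hr' : (r : ℝ) ≤ M := by exact_mod_cast hr
    have hr0 : (0 : ℝ) ≤ r := r.cast_nonneg
    have hcast : ((n - (M - r) : ℕ) : ℝ) = n - M + r := by
      rw [Nat.cast_sub (by omega), Nat.cast_sub hr]
      ring
    simp only [logSup, hcast]
    have hz : 0 < (n : ℝ) - M + r + r + 3 := by linarith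
    have h1 : Real.log (n - M + r + r + 3) ≤ Real.log (n + 3) + 1 / (n + 3) * (2 * r - M) := by
      have h2 := Real.log_le_sub_one_of_pos (div_pos hz hpos)
      rw [Real.log_div hz.ne' hpos.ne'] at h2
      have : ((n : ℝ) - M + r + r + 3) / (n + 3) - 1 = 1 / (n + 3) * (2 * r - M) := by
        field_simp
        ring
      linarith
    have h2 : ((n : ℝ) - M) / (n + M + 4) ^ 2 ≤ (n - M + r) / (n - M + r + r + 4) ^ 2 := by
      apply div_le_div₀ (by linarith) (by linarith) (by positivity)
      apply pow_le_pow_left₀ (by linarith)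
      linarith
    linarith
  · simp only [logSup]
    have e : ((n : ℝ) - M) / (n + M + 4) ^ 2 - 1 / (n + 3) * δ
        = -(1 / (n + 3)) *
          (δ - (1 - (M + 3 : ℝ) / (n + 3)) / (1 + (M + 1 : ℝ) / (n + 3)) ^ 2) := by
      have h5 : 1 + (M + 1 : ℝ) / (n + 3) = (n + M + 4) / (n + 3) := by field_simp; ring
      have h6 : 1 - (M + 3 : ℝ) / (n + 3) = (n - M) / (n + 3) := by field_simp; ring
      have h7 : (0 : ℝ) < n + M + 4 := by linarith
      rw [h5, h6]
      field_simp
      ring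
    have h3 : 0 ≤ -(1 / ((n : ℝ) + 3)) *
          (δ - (1 - (M + 3 : ℝ) / (n + 3)) / (1 + (M + 1 : ℝ) / (n + 3)) ^ 2) := by
      have : 0 < 1 / ((n : ℝ) + 3) := by positivity
      nlinarith
    push_cast
    rw [zero_div, zero_add, sub_zero]
    linarith

/-! ### The power-law supersolution for drift above one -/

/-- Bernoulli's inequality with exponent `a` in `[0, 1]`, applied to `(z / (z + d)) ^ a`. -/
lemma rpow_neg_shift_le {a z d : ℝ} (ha0 : 0 ≤ a) (ha1 : a ≤ 1) (hz : 0 < z) (hzd : 0 < z + d) :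
    (z + d) ^ (-a) ≤ z ^ (-a) * (1 - a * d / (z + d)) := by
  have h := rpow_one_add_le_one_add_mul_self (s := -d / (z + d)) (p := a)
    (by rw [le_div_iff₀ hzd]; linarith) ha0 ha1
  have e : 1 + -d / (z + d) = z / (z + d) := by field_simp; ring
  rw [e, Real.div_rpow hz.le hzd.le] at h
  rw [Real.rpow_neg hz.le, Real.rpow_neg hzd.le]
  have hz' : 0 < z ^ a := Real.rpow_pos_of_pos hz a
  have hzd' : 0 < (z + d) ^ a := Real.rpow_pos_of_pos hzd a
  have := mul_le_mul_of_nonneg_left h (inv_pos.2 hz').le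
  calc ((z + d) ^ a)⁻¹ = (z ^ a)⁻¹ * (z ^ a / (z + d) ^ a) := by field_simp
    _ ≤ (z ^ a)⁻¹ * (1 + a * (-d / (z + d))) := this
    _ = _ := by ring

lemma exp_le_one_add_add_sq {t : ℝ} (ht : |t| ≤ 1) : Real.exp t ≤ 1 + t + t ^ 2 := by
  have := (abs_le.1 (Real.abs_exp_sub_one_sub_id_le ht)).2
  linarith

lemma abs_log_one_add_le {u : ℝ} (hu : |u| ≤ 1 / 2) : |Real.log (1 + u)| ≤ 2 * |u| := by
  obtain ⟨h1, h2⟩ := abs_le.1 hu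
  have hpos : 0 < 1 + u := by linarith
  have hup := Real.log_le_sub_one_of_pos hpos
  have hlo := Real.one_sub_inv_le_log_of_pos hpos
  have h3 : |u| ≤ 2 * |u| := by linarith [abs_nonneg u]
  have h4 : 1 - (1 + u)⁻¹ = u / (1 + u) := by field_simp; ring
  have h5 : |u / (1 + u)| ≤ 2 * |u| := by
    rw [abs_div, abs_of_pos hpos, div_le_iff₀ hpos]
    nlinarith [abs_nonneg u]
  rw [abs_le]
  constructor
  · linarith [(abs_le.1 h5).1]
  · linarith [le_abs_self u]

/-- Both powers are exponentials of `-a * log (1 ± u)`. The linear terms sum to `-a * log (1 - u ^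
2)`, at most `a * (1 + 2 * a) * u ^ 2`, and the quadratic ones to at most `8 * a ^ 2 * u ^ 2`; hence
the `10`. -/
lemma rpow_second_difference_le {a u : ℝ} (ha0 : 0 < a) (ha1 : a ≤ 1 / 10) (hu0 : 0 < u)
    (hu : u ≤ 1 / 2) (hua : u ^ 2 ≤ a) :
    (1 + u) ^ (-a) + (1 - u) ^ (-a) ≤ 2 + a * (1 + 10 * a) * u ^ 2 := by
  have hp : 0 < 1 + u := by linarith
  have hm : 0 < 1 - u := by linarith
  have l1 := abs_log_one_add_le (u := u) (by rw [abs_of_pos hu0]; exact hu)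
  have l2 := abs_log_one_add_le (u := -u) (by rw [abs_neg, abs_of_pos hu0]; exact hu)
  rw [abs_neg, abs_of_pos hu0, ← sub_eq_add_neg] at l2
  rw [abs_of_pos hu0] at l1
  have q1 : Real.log (1 + u) ^ 2 ≤ 4 * u ^ 2 := by
    nlinarith [sq_abs (Real.log (1 + u)), abs_nonneg (Real.log (1 + u))]
  have q2 : Real.log (1 - u) ^ 2 ≤ 4 * u ^ 2 := by
    nlinarith [sq_abs (Real.log (1 - u)), abs_nonneg (Real.log (1 - u))]
  have hb : ∀ l : ℝ, |l| ≤ 2 * u → |l * -a| ≤ 1 := fun l hl => by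
    rw [abs_mul, abs_neg, abs_of_pos ha0]
    nlinarith [abs_nonneg l]
  rw [Real.rpow_def_of_pos hp, Real.rpow_def_of_pos hm]
  have x1 := exp_le_one_add_add_sq (hb _ l1)
  have x2 := exp_le_one_add_add_sq (hb _ l2)
  have hsum : -(Real.log (1 + u) + Real.log (1 - u)) ≤ u ^ 2 * (1 + 2 * a) := by
    rw [← Real.log_mul hp.ne' hm.ne']
    have e : (1 + u) * (1 - u) = 1 - u ^ 2 := by ring
    have h1 : 0 < 1 - u ^ 2 := by nlinarith
    rw [e]
    have h2 := Real.one_sub_inv_le_log_of_pos h1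
    have h3 : (1 - u ^ 2)⁻¹ ≤ 1 + u ^ 2 * (1 + 2 * a) := by
      rw [inv_le_comm₀ h1 (by positivity), inv_le_iff_one_le_mul₀ (by positivity)]
      nlinarith [sq_nonneg u, mul_nonneg (sq_nonneg u) ha0.le, sq_nonneg (u ^ 2)]
    linarith
  have a2 : 0 ≤ a ^ 2 := sq_nonneg a
  nlinarith [mul_le_mul_of_nonneg_left q1 a2, mul_le_mul_of_nonneg_left q2 a2,
    mul_le_mul_of_nonneg_left hsum ha0.le]

lemma inv_sq_second_difference_le {a z : ℝ} (ha1 : a ≤ 1) (hz : 9 ≤ z) :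
    (1 - a * 1 / (z + 1)) / (z + 1) ^ 2 + (1 - a * -1 / (z + -1)) / (z + -1) ^ 2
      ≤ (2 + 27 / z ^ 2) / z ^ 2 := by
  -- In the variable `w ≥ 0` the cleared inequalities become polynomials with nonnegative
  -- coefficients. The constant `27` is `11 + 16`.
  obtain ⟨w, hw, rfl⟩ : ∃ w : ℝ, 0 ≤ w ∧ z = w + 9 := ⟨z - 9, by linarith, by ring⟩
  have h1 : 1 / (w + 10) ^ 2 + 1 / (w + 8) ^ 2 ≤ 2 / (w + 9) ^ 2 + 11 / (w + 9) ^ 4 := by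
    rw [div_add_div _ _ (by positivity) (by positivity),
      div_add_div _ _ (by positivity) (by positivity),
      div_le_div_iff₀ (by positivity) (by positivity), ← sub_nonneg]
    ring_nf
    positivity
  have h2 : 1 / (w + 8) ^ 3 - 1 / (w + 10) ^ 3 ≤ 16 / (w + 9) ^ 4 := by
    rw [div_sub_div _ _ (by positivity) (by positivity),
      div_le_div_iff₀ (by positivity) (by positivity), ← sub_nonneg]
    ring_nf
    positivity
  have h3 : 0 ≤ 1 / (w + 8) ^ 3 - 1 / (w + 10) ^ 3 := by
    rw [sub_nonneg]
    gcongr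
    norm_num
  have h4 : a * (1 / (w + 8) ^ 3 - 1 / (w + 10) ^ 3) ≤ 16 / (w + 9) ^ 4 := by nlinarith
  have e1 : w + 9 + 1 = w + 10 := by ring
  have e2 : w + 9 + -1 = w + 8 := by ring
  have hw8 : w + 8 ≠ 0 := by positivity
  have hw9 : w + 9 ≠ 0 := by positivity
  have hw10 : w + 10 ≠ 0 := by positivity
  rw [e1, e2]
  have e3 : (1 - a * 1 / (w + 10)) / (w + 10) ^ 2 + (1 - a * -1 / (w + 8)) / (w + 8) ^ 2
      = 1 / (w + 10) ^ 2 + 1 / (w + 8) ^ 2 + a * (1 / (w + 8) ^ 3 - 1 / (w + 10) ^ 3) := by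
    field_simp
    ring
  have e4 : (2 + 27 / (w + 9) ^ 2) / (w + 9) ^ 2
      = 2 / (w + 9) ^ 2 + 11 / (w + 9) ^ 4 + 16 / (w + 9) ^ 4 := by
    field_simp
    ring
  rw [e3, e4]
  linarith

/-- The power-law supersolution of the exploration of fair stacks. -/
noncomputable def powSup (a c : ℝ) (v : ℕ × ℕ) : ℝ :=
  (v.1 + v.2 + c) ^ (-a) * (1 + v.1 * (a * (1 + 20 * a)) / (v.1 + v.2 + c) ^ 2)

lemma powSup_nonneg {a c : ℝ} (ha : 0 ≤ a) (hc : 0 ≤ c) (v : ℕ × ℕ) : 0 ≤ powSup a c v := by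
  unfold powSup
  positivity

lemma powSup_zero_left (a c : ℝ) (n : ℕ) : powSup a c (0, n) = (n + c) ^ (-a) := by
  simp [powSup]

/-- The second difference of the power is at most `a * (1 + 10 * a) / z ^ 2` in relative size, and a
left arrow lowers the correction by about `κ / z ^ 2`, where `κ = a * (1 + 20 * a)`. The surplus `10
* a ^ 2` in `κ` absorbs the error of the correction term, since `z ≥ 9 / a`. -/
lemma powSup_super {a c : ℝ} (ha0 : 0 < a) (ha1 : a ≤ 1 / 10) (hc : 9 / a ≤ c) (k y : ℕ) :
    powSup a c (k + 1, y + 1) + powSup a c (k, y) ≤ 2 * powSup a c (k + 1, y) := by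
  simp only [powSup]
  push_cast
  obtain ⟨z, hz⟩ : ∃ z : ℝ, z = k + 1 + y + c := ⟨_, rfl⟩
  obtain ⟨κ, hκ⟩ : ∃ κ : ℝ, κ = a * (1 + 20 * a) := ⟨_, rfl⟩
  have hk : (0 : ℝ) ≤ k := k.cast_nonneg
  have hy : (0 : ℝ) ≤ y := y.cast_nonneg
  have hca : 9 ≤ c * a := by rwa [div_le_iff₀ ha0] at hc
  have hc90 : 90 ≤ c := by nlinarith
  have hz9 : 9 ≤ z := by linarith
  have hza : 9 ≤ z * a := by nlinarith
  have e1 : (k : ℝ) + 1 + (y + 1) + c = z + 1 := by rw [hz]; ring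
  have e3 : (k : ℝ) + y + c = z + -1 := by rw [hz]; ring
  rw [e1, e3, ← hz, ← hκ]
  have hz0 : 0 < z := by linarith
  have hκ0 : 0 < κ := by rw [hκ]; positivity
  set A := z ^ (-a) with hA
  have hA0 : 0 < A := Real.rpow_pos_of_pos hz0 _
  have s1 : (z + 1) ^ (-a) ≤ A * (1 - a * 1 / (z + 1)) :=
    rpow_neg_shift_le ha0.le (by linarith) hz0 (by linarith)
  have s2 : (z + -1) ^ (-a) ≤ A * (1 - a * -1 / (z + -1)) :=
    rpow_neg_shift_le ha0.le (by linarith) hz0 (by linarith)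
  have s3 : A ≤ (z + -1) ^ (-a) :=
    Real.rpow_le_rpow_of_nonpos (by linarith) (by linarith) (by linarith)
  have s4 : (z + 1) ^ (-a) + (z + -1) ^ (-a) ≤ A * (2 + a * (1 + 10 * a) / z ^ 2) := by
    have h := rpow_second_difference_le (u := 1 / z) ha0 ha1 (by positivity)
      (by rw [div_le_div_iff₀ hz0 (by norm_num)]; linarith)
      (by rw [div_pow, one_pow, div_le_iff₀ (by positivity)]; nlinarith)
    have i1 : z + 1 = z * (1 + 1 / z) := by field_simp
    have i2 : z + -1 = z * (1 - 1 / z) := by field_simp; ring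
    have hz1 : 1 / z ≤ 1 := by rw [div_le_one hz0]; linarith
    rw [i1, i2, Real.mul_rpow hz0.le (by positivity), Real.mul_rpow hz0.le (by linarith),
      ← mul_add]
    refine mul_le_mul_of_nonneg_left (h.trans_eq ?_) hA0.le
    ring
  have s5 := inv_sq_second_difference_le (a := a) (by linarith) hz9
  have s6 : (z + 1) ^ (-a) / (z + 1) ^ 2 + (z + -1) ^ (-a) / (z + -1) ^ 2
      ≤ A * ((2 + 27 / z ^ 2) / z ^ 2) := by
    calc _ ≤ A * (1 - a * 1 / (z + 1)) / (z + 1) ^ 2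
          + A * (1 - a * -1 / (z + -1)) / (z + -1) ^ 2 := by gcongr
      _ = A * ((1 - a * 1 / (z + 1)) / (z + 1) ^ 2
          + (1 - a * -1 / (z + -1)) / (z + -1) ^ 2) := by ring
      _ ≤ _ := mul_le_mul_of_nonneg_left s5 hA0.le
  have s7 : A / z ^ 2 ≤ (z + -1) ^ (-a) / (z + -1) ^ 2 := by
    apply div_le_div₀ (hA0.le.trans s3) s3 (by apply pow_pos; linarith)
    apply pow_le_pow_left₀ (by linarith)
    linarith
  have s8 : a * (1 + 10 * a) + 27 * κ * (k + 1) / z ^ 2 ≤ κ := by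
    have h1 : 27 * κ * (k + 1) / z ^ 2 ≤ 10 * a ^ 2 := by
      rw [div_le_iff₀ (by positivity)]
      have h2 : (k : ℝ) + 1 ≤ z := by linarith
      have h3 : κ ≤ 3 * a := by rw [hκ]; nlinarith
      calc 27 * κ * (k + 1) ≤ 27 * (3 * a) * z := by gcongr
        _ ≤ 10 * a * z * 9 := by nlinarith [mul_pos ha0 hz0]
        _ ≤ 10 * a * z * (z * a) := by gcongr
        _ = 10 * a ^ 2 * z ^ 2 := by ring
    rw [hκ] at h1 ⊢
    nlinarith
  have hk1 : 0 ≤ ((k : ℝ) + 1) * κ := by positivity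
  calc (z + 1) ^ (-a) * (1 + (k + 1) * κ / (z + 1) ^ 2)
        + (z + -1) ^ (-a) * (1 + k * κ / (z + -1) ^ 2)
      = ((z + 1) ^ (-a) + (z + -1) ^ (-a))
        + (k + 1) * κ * ((z + 1) ^ (-a) / (z + 1) ^ 2 + (z + -1) ^ (-a) / (z + -1) ^ 2)
        - κ * ((z + -1) ^ (-a) / (z + -1) ^ 2) := by ring
    _ ≤ A * (2 + a * (1 + 10 * a) / z ^ 2) + (k + 1) * κ * (A * ((2 + 27 / z ^ 2) / z ^ 2))
        - κ * (A / z ^ 2) := by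
        have := mul_le_mul_of_nonneg_left s6 hk1
        have := mul_le_mul_of_nonneg_left s7 hκ0.le
        linarith
    _ = 2 * (A * (1 + (k + 1) * κ / z ^ 2))
        + A / z ^ 2 * (a * (1 + 10 * a) + 27 * κ * (k + 1) / z ^ 2 - κ) := by ring
    _ ≤ _ := by
        have : 0 < A / z ^ 2 := by positivity
        nlinarith

/-- The power law is superharmonic far away from the origin if `δ > 1`. -/
lemma exists_powSup_drift {δ : ℝ} (hδ : 1 < δ) (M : ℕ) : ∃ a c : ℝ, 0 < a ∧ a ≤ 1 / 10 ∧
    9 / a ≤ c ∧ ∃ N : ℕ, M ≤ N ∧ ∀ n ≥ N, ∃ c₀ c₁ : ℝ,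
    (∀ r ≤ M, powSup a c (n - (M - r), r) ≤ c₀ + c₁ * (2 * r - M)) ∧
      c₀ + c₁ * δ ≤ powSup a c (0, n) := by
  -- Small enough for the drift gain `a * δ` to exceed the correction coefficient `κ = a * (1 + 20 *
  -- a)`.
  obtain ⟨a, ha0, ha1, haδ⟩ : ∃ a : ℝ, 0 < a ∧ a ≤ 1 / 10 ∧ 1 + 20 * a < δ := by
    refine ⟨min ((δ - 1) / 40) (1 / 10), lt_min (by linarith) (by norm_num), min_le_right _ _, ?_⟩
    have := min_le_left ((δ - 1) / 40) (1 / 10)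
    linarith
  refine ⟨a, 9 / a, ha0, ha1, le_rfl, ?_⟩
  obtain ⟨κ, hκ⟩ : ∃ κ : ℝ, κ = a * (1 + 20 * a) := ⟨_, rfl⟩
  have hκ0 : 0 < κ := by rw [hκ]; positivity
  have hκδ : κ < a * δ := by rw [hκ]; exact mul_lt_mul_of_pos_left haδ ha0
  obtain ⟨c, hc⟩ : ∃ c : ℝ, c = 9 / a := ⟨_, rfl⟩
  have hc0 : 0 < c := by rw [hc]; positivity
  rw [← hc]
  -- With `z = n + c`, `A = z ^ (-a)` and `t = 1 / (z - M)`, the bound `c₀ + c₁ * δ` below equals `A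
  -- + A / z * E t`; as `n` grows, `E t` tends to `κ - a * δ < 0`.
  let E : ℝ → ℝ := fun t => -(a * δ) + a * M ^ 2 * t + κ * (1 + M * t) ^ 2 * (1 + a * M * t)
  have hE : Continuous E := by fun_prop
  have hlim : Tendsto (fun n : ℕ => E (1 / (n + c - M))) atTop (nhds (E 0)) := by
    refine (hE.tendsto 0).comp (Tendsto.div_atTop tendsto_const_nhds ?_)
    have : Tendsto (fun n : ℕ => (n : ℝ) + (c - M)) atTop atTop :=
      tendsto_atTop_add_const_right _ _ tendsto_natCast_atTop_atTop
    simpa only [add_sub_assoc] using this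
  have hev := hlim.eventually (gt_mem_nhds (show E 0 < 0 by simp only [E]; linarith))
  obtain ⟨N, hN⟩ := eventually_atTop.1 hev
  refine ⟨max N M, le_max_right _ _, fun n hn => ?_⟩
  have hnM : M ≤ n := (le_max_right _ _).trans hn
  have hn0 := hN n ((le_max_left _ _).trans hn)
  have hn' : (M : ℝ) ≤ n := by exact_mod_cast hnM
  have hM0 : (0 : ℝ) ≤ M := M.cast_nonneg
  obtain ⟨z, hz⟩ : ∃ z : ℝ, z = n + c := ⟨_, rfl⟩
  obtain ⟨t, ht⟩ : ∃ t : ℝ, t = 1 / (z - M) := ⟨_, rfl⟩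
  have hz0 : 0 < z := by linarith
  have hzM : 0 < z - M := by linarith
  have ht0 : 0 < t := by rw [ht]; positivity
  set A := z ^ (-a) with hA
  have hA0 : 0 < A := Real.rpow_pos_of_pos hz0 _
  rw [← hz, ← ht] at hn0
  refine ⟨A * (1 + a * M ^ 2 * t / z + κ * z * (1 + a * M * t) * t ^ 2), -(A * a / z),
    fun r hr => ?_, ?_⟩
  · have hr' : (r : ℝ) ≤ M := by exact_mod_cast hr
    have hr0 : (0 : ℝ) ≤ r := r.cast_nonneg
    have hcast : ((n - (M - r) : ℕ) : ℝ) = n - M + r := by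
      rw [Nat.cast_sub (by omega), Nat.cast_sub hr]
      ring
    simp only [powSup, hcast]
    obtain ⟨d, hd⟩ : ∃ d : ℝ, d = 2 * r - M := ⟨_, rfl⟩
    have hdM : -M ≤ d := by linarith
    have hdM' : d ≤ M := by linarith
    have e : (n : ℝ) - M + r + r + c = z + d := by rw [hz, hd]; ring
    rw [e, ← hκ, ← hd]
    have hzd : z - M ≤ z + d := by linarith
    have hzd0 : 0 < z + d := by linarith
    have hinv : 1 / (z + d) ≤ t := by
      rw [ht]
      exact one_div_le_one_div_of_le hzM hzd
    have h1 : (z + d) ^ (-a) ≤ A * (1 - a * d / (z + d)) :=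
      rpow_neg_shift_le ha0.le (by linarith) hz0 hzd0
    have h2 : 1 - a * d / (z + d) ≤ 1 - a * d / z + a * M ^ 2 * t / z := by
      have i1 : 1 - a * d / (z + d) = 1 - a * d / z + a * d ^ 2 * (1 / (z + d)) / z := by
        field_simp
        ring
      have i2 : d ^ 2 ≤ M ^ 2 := by nlinarith
      rw [i1]
      gcongr
    have h3 : 1 - a * d / (z + d) ≤ 1 + a * M * t := by
      have i1 : 1 - a * d / (z + d) = 1 + a * (-d) * (1 / (z + d)) := by ring
      rw [i1]
      have i2 : a * (-d) * (1 / (z + d)) ≤ a * M * (1 / (z + d)) := by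
        gcongr
        linarith
      have i3 : a * M * (1 / (z + d)) ≤ a * M * t := by gcongr
      linarith
    have h4 : (n - M + r) * κ / (z + d) ^ 2 ≤ z * κ * t ^ 2 := by
      have i1 : (n - M + r) * κ / (z + d) ^ 2 = (n - M + r) * κ * (1 / (z + d)) ^ 2 := by
        rw [one_div_pow, ← div_eq_mul_one_div]
      rw [i1]
      have : (n : ℝ) - M + r ≤ z := by linarith
      gcongr
    have hp0 : 0 ≤ (z + d) ^ (-a) := Real.rpow_nonneg hzd0.le _
    calc (z + d) ^ (-a) * (1 + (n - M + r) * κ / (z + d) ^ 2)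
        ≤ (z + d) ^ (-a) * (1 + z * κ * t ^ 2) := by gcongr
      _ = (z + d) ^ (-a) + (z + d) ^ (-a) * (z * κ * t ^ 2) := by ring
      _ ≤ A * (1 - a * d / z + a * M ^ 2 * t / z) + A * (1 + a * M * t) * (z * κ * t ^ 2) := by
          gcongr
          · exact h1.trans (mul_le_mul_of_nonneg_left h2 hA0.le)
          · exact h1.trans (mul_le_mul_of_nonneg_left h3 hA0.le)
      _ = _ := by ring
  · rw [powSup_zero_left, ← hz, ← hA]
    have hzt : z * t = 1 + M * t := by
      rw [ht]
      field_simp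
      ring
    have key : A * (1 + a * M ^ 2 * t / z + κ * z * (1 + a * M * t) * t ^ 2) + -(A * a / z) * δ
        = A + A / z * E t := by
      have : E t = -(a * δ) + a * M ^ 2 * t + κ * (z * t) ^ 2 * (1 + a * M * t) := by
        rw [hzt]
      rw [this]
      field_simp
      ring
    rw [key]
    have : 0 < A / z := by positivity
    nlinarith

/-! ### Random stacks generated by cookies, and their drift -/

/-- The stack of arrows obtained from the cookies `p` and the uniform variables `u`. -/
noncomputable def stackOf (p u : ℕ → unitInterval) (i : ℕ) : Bool := decide (u i < p i)

/-- The law of a sequence of independent uniform variables. -/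
noncomputable def uniformSeq : Measure (ℕ → unitInterval) :=
  Measure.infinitePi fun _ : ℕ => (volume : Measure unitInterval)

instance : IsProbabilityMeasure uniformSeq := by unfold uniformSeq; infer_instance

/-- The law of a stack of arrows whose cookies have law `ρ`. -/
noncomputable def stackLaw (ρ : Measure (ℕ → unitInterval)) : Measure (ℕ → Bool) :=
  (ρ.prod uniformSeq).map fun q => stackOf q.1 q.2

/-- The probability that a cookie of strength `p` produces the arrow `b`. -/
noncomputable def cookieWeight (p : unitInterval) (b : Bool) : ℝ≥0∞ :=
  if b then ENNReal.ofReal p else ENNReal.ofReal (1 - p)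

lemma measurable_decide_lt :
    Measurable fun q : unitInterval × unitInterval => decide (q.1 < q.2) := by
  refine measurable_to_bool ?_
  have : (fun q : unitInterval × unitInterval => decide (q.1 < q.2)) ⁻¹' {true}
      = {q | q.1 < q.2} := by
    ext q
    simp
  rw [this]
  exact measurableSet_lt measurable_fst measurable_snd

lemma measurable_stackOf :
    Measurable fun q : (ℕ → unitInterval) × (ℕ → unitInterval) => stackOf q.1 q.2 :=
  measurable_pi_iff.2 fun i => by
    have h : Measurable fun q : (ℕ → unitInterval) × (ℕ → unitInterval) => (q.2 i, q.1 i) :=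
      ((measurable_pi_apply i).comp measurable_snd).prodMk
        ((measurable_pi_apply i).comp measurable_fst)
    exact measurable_decide_lt.comp h

lemma measurable_stackOf_right (p : ℕ → unitInterval) : Measurable (stackOf p) :=
  measurable_stackOf.comp measurable_prodMk_left

instance (ρ : Measure (ℕ → unitInterval)) [IsProbabilityMeasure ρ] :
    IsProbabilityMeasure (stackLaw ρ) :=
  Measure.isProbabilityMeasure_map measurable_stackOf.aemeasurable

lemma volume_decide_lt (p : unitInterval) (b : Bool) :
    volume {u : unitInterval | decide (u < p) = b} = cookieWeight p b := by
  cases b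
  · have : {u : unitInterval | decide (u < p) = false} = Set.Ici p := by
      ext u
      simp
    rw [this, unitInterval.volume_Ici]
    simp [cookieWeight]
  · have : {u : unitInterval | decide (u < p) = true} = Set.Iio p := by
      ext u
      simp
    rw [this, unitInterval.volume_Iio]
    simp [cookieWeight]

lemma measurableSet_decide_lt (p : unitInterval) (b : Bool) :
    MeasurableSet {u : unitInterval | decide (u < p) = b} :=
  (measurable_decide_lt.comp measurable_prodMk_right) (measurableSet_singleton b)

lemma iIndepFun_stackOf (p : ℕ → unitInterval) :
    iIndepFun (fun i u => stackOf p u i) uniformSeq :=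
  iIndepFun_infinitePi (X := fun i (u : unitInterval) => decide (u < p i))
    fun _ => measurable_decide_lt.comp measurable_prodMk_right

lemma uniformSeq_stackOf_eq (p : ℕ → unitInterval) (i : ℕ) (b : Bool) :
    uniformSeq {u | stackOf p u i = b} = cookieWeight (p i) b := by
  rw [← volume_decide_lt, ← Measure.infinitePi_map_eval
    (fun _ : ℕ => (volume : Measure unitInterval)) i, Measure.map_apply (measurable_pi_apply i)
    (measurableSet_decide_lt _ _)]
  rfl

lemma lintegral_stackLaw (ρ : Measure (ℕ → unitInterval)) [SFinite ρ] {G : (ℕ → Bool) → ℝ≥0∞}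
    (hG : Measurable G) :
    ∫⁻ s, G s ∂(stackLaw ρ) = ∫⁻ p, ∫⁻ u, G (stackOf p u) ∂uniformSeq ∂ρ := by
  have hG' : Measurable fun q : (ℕ → unitInterval) × (ℕ → unitInterval) => G (stackOf q.1 q.2) :=
    hG.comp measurable_stackOf
  rw [stackLaw, lintegral_map hG measurable_stackOf, lintegral_prod _ hG'.aemeasurable]

lemma stackLaw_apply (ρ : Measure (ℕ → unitInterval)) [SFinite ρ] {A : Set (ℕ → Bool)}
    (hA : MeasurableSet A) :
    stackLaw ρ A = ∫⁻ p, uniformSeq {u | stackOf p u ∈ A} ∂ρ := by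
  rw [stackLaw, Measure.map_apply measurable_stackOf hA,
    Measure.prod_apply (measurable_stackOf hA)]
  rfl

lemma cookieWeight_half {p : unitInterval} (hp : (p : ℝ) = 1 / 2) (b : Bool) :
    cookieWeight p b = 2⁻¹ := by
  have : (1 : ℝ) - 1 / 2 = 2⁻¹ := by norm_num
  cases b <;> simp only [cookieWeight, hp, this] <;>
    simp [ENNReal.ofReal_inv_of_pos]

section Drift

variable {ρ : Measure (ℕ → unitInterval)} [IsProbabilityMeasure ρ] {M : ℕ}

lemma ae_goodStack_stackLaw (hρ : ∀ᵐ p ∂ρ, ∀ i, M ≤ i → (p i : ℝ) = 1 / 2) :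
    ∀ᵐ s ∂(stackLaw ρ), GoodStack s := by
  have hset : MeasurableSet {s : ℕ → Bool | ¬ GoodStack s} := measurableSet_goodStack.compl
  rw [ae_iff, stackLaw_apply ρ hset, lintegral_eq_zero_iff]
  · filter_upwards [hρ] with p hp
    have := ae_goodStack (iIndepFun_stackOf p) (fun i => (measurable_pi_apply i).comp
      (measurable_stackOf_right p)) (M := M) fun b i hi => by
        rw [uniformSeq_stackOf_eq, cookieWeight_half (hp i hi)]
    exact ae_iff.1 this
  · exact measurable_measure_prodMk_left (measurable_stackOf hset)

/-- With positive probability a stack starts with `n` left arrows. -/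
lemma stackLaw_rightsBefore_pos (hρ : 0 < ρ {p | ∀ i, (p i : ℝ) < 1}) (n : ℕ) :
    0 < stackLaw ρ {s | rightsBefore s n = 0} := by
  have hset : MeasurableSet {s : ℕ → Bool | rightsBefore s n = 0} :=
    measurable_rightsBefore n (measurableSet_singleton 0)
  have hsub : ∀ s : ℕ → Bool, (∀ i < n, s i = false) → rightsBefore s n = 0 := fun s hs => by
    have hl : ∀ t ≤ n, lefts s t = t := fun t => by
      induction t with
      | zero => simp
      | succ t ih => intro ht; rw [lefts_succ, ih (by omega), if_pos (hs t (by omega))]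
    have hle : sInf {t | lefts s t = n} ≤ n := Nat.sInf_le (s := {t | lefts s t = n}) (hl n le_rfl)
    have h1 := hl _ hle
    have h2 := rights_add_lefts s (sInf {t | lefts s t = n})
    rw [rightsBefore]
    omega
  rw [stackLaw_apply ρ hset]
  have hmeas : Measurable fun p => uniformSeq {u | stackOf p u ∈ {s | rightsBefore s n = 0}} :=
    measurable_measure_prodMk_left (measurable_stackOf hset)
  rw [lintegral_pos_iff_support hmeas]
  -- For each fixed cookie stack with all entries below `1`, a run of `n` left arrows has
  -- probability a product of positive factors.
  refine hρ.trans_le (measure_mono fun p hp => ?_)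
  rw [Function.mem_support]
  refine (lt_of_lt_of_le ?_ (measure_mono (s := ⋂ i ∈ Finset.range n, {u | stackOf p u i = false})
    fun u hu => hsub _ fun i hi => ?_)).ne'
  · rw [(iIndepFun_stackOf p).meas_biInter (s := fun i => {u | stackOf p u i = false}) fun i _ =>
      ⟨{false}, measurableSet_singleton false, rfl⟩]
    refine CanonicallyOrderedAdd.prod_pos.2 fun i _ => ?_
    rw [uniformSeq_stackOf_eq]
    simpa [cookieWeight] using hp i
  · simp only [Set.mem_iInter] at hu
    exact hu i (Finset.mem_range.2 hi)

lemma lintegral_rightsBefore_stackLaw_le (hρ : ∀ᵐ p ∂ρ, ∀ i, M ≤ i → (p i : ℝ) = 1 / 2)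
    {B : ℕ × ℕ → ℝ≥0∞}
    (hB : ∀ k y, 2⁻¹ * B (k + 1, y + 1) + 2⁻¹ * B (k, y) ≤ B (k + 1, y)) (n : ℕ) :
    ∫⁻ s, B (0, rightsBefore s n) ∂(stackLaw ρ) ≤ ∫⁻ s, B (stackState s n M) ∂(stackLaw ρ) := by
  have h1 : Measurable fun s => B (0, rightsBefore s n) :=
    (measurable_of_countable fun y => B (0, y)).comp (measurable_rightsBefore n)
  have h2 : Measurable fun s => B (stackState s n M) :=
    (measurable_of_countable B).comp (measurable_stackState n M)
  rw [lintegral_stackLaw ρ h1, lintegral_stackLaw ρ h2]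
  refine lintegral_mono_ae ?_
  filter_upwards [hρ] with p hp
  exact lintegral_rightsBefore_le (iIndepFun_stackOf p) (fun i => (measurable_pi_apply i).comp
    (measurable_stackOf_right p)) (fun b i hi => by
      rw [uniformSeq_stackOf_eq, cookieWeight_half (hp i hi)]) hB n

lemma integral_stackOf_sign (p : ℕ → unitInterval) (i : ℕ) :
    ∫ u, (if stackOf p u i = true then (1 : ℝ) else -1) ∂uniformSeq = 2 * p i - 1 := by
  have hm : MeasurableSet {u | stackOf p u i = true} :=
    ((measurable_pi_apply i).comp (measurable_stackOf_right p)) (measurableSet_singleton true)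
  have e : ∀ u, (if stackOf p u i = true then (1 : ℝ) else -1)
      = 2 * {u | stackOf p u i = true}.indicator 1 u - 1 := fun u => by
    by_cases h : stackOf p u i = true
    · simp [h]; norm_num
    · simp [h]
  simp only [e]
  have hi : Integrable ({u | stackOf p u i = true}.indicator (1 : (ℕ → unitInterval) → ℝ))
      uniformSeq := (integrable_const (1 : ℝ)).indicator hm
  rw [integral_sub (hi.const_mul 2) (integrable_const _),
    integral_const_mul, integral_indicator_one hm, measureReal_def, uniformSeq_stackOf_eq]
  simp [cookieWeight, (p i).2.1]

lemma two_mul_rights_sub (s : ℕ → Bool) (t : ℕ) :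
    2 * (rights s t : ℝ) - t = ∑ i ∈ Finset.range t, if s i = true then (1 : ℝ) else -1 := by
  induction t with
  | zero => simp
  | succ t ih =>
    rw [Finset.sum_range_succ, ← ih, rights_succ]
    split_ifs <;> push_cast <;> ring

lemma integral_rights_stackLaw (ρ : Measure (ℕ → unitInterval)) [IsProbabilityMeasure ρ] (M : ℕ) :
    ∫ s, (2 * (rights s M : ℝ) - M) ∂(stackLaw ρ)
      = ∫ p, ∑ i ∈ Finset.range M, (2 * (p i : ℝ) - 1) ∂ρ := by
  have hmeas : ∀ i, Measurable fun s : ℕ → Bool => if s i = true then (1 : ℝ) else -1 := fun i =>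
    (measurable_of_countable fun b : Bool => if b = true then (1 : ℝ) else -1).comp
      (measurable_pi_apply i)
  have hbd : ∀ b : Bool, ‖if b = true then (1 : ℝ) else -1‖ ≤ 1 := fun b => by cases b <;> simp
  have hsm : Measurable fun s : ℕ → Bool => ∑ i ∈ Finset.range M, if s i = true then (1 : ℝ) else -1 :=
    Finset.measurable_sum _ fun i _ => hmeas i
  simp only [two_mul_rights_sub]
  rw [stackLaw, integral_map measurable_stackOf.aemeasurable hsm.aestronglyMeasurable,
    integral_prod]
  · refine integral_congr_ae (ae_of_all _ fun p => ?_)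
    change ∫ u, ∑ i ∈ Finset.range M, (if stackOf p u i = true then (1 : ℝ) else -1) ∂uniformSeq = _
    rw [integral_finsetSum]
    · exact Finset.sum_congr rfl fun i _ => integral_stackOf_sign p i
    · exact fun i _ => Integrable.of_bound
        ((hmeas i).comp (measurable_stackOf_right p)).aestronglyMeasurable 1
        (ae_of_all _ fun u => hbd _)
  · refine integrable_finsetSum _ fun i _ => Integrable.of_bound
      ((hmeas i).comp measurable_stackOf).aestronglyMeasurable 1 (ae_of_all _ fun q => hbd _)

/-- A supersolution of the fair exploration which is dominated by an affine function of the number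
of right arrows among the cookies bounds the transition operator. -/
lemma branchingOp_stackLaw_le (hρ : ∀ᵐ p ∂ρ, ∀ i, M ≤ i → (p i : ℝ) = 1 / 2)
    {B : ℕ × ℕ → ℝ} (hB0 : ∀ v, 0 ≤ B v)
    (hB : ∀ k y, B (k + 1, y + 1) + B (k, y) ≤ 2 * B (k + 1, y)) {n : ℕ} (hn : M ≤ n) {c₀ c₁ : ℝ}
    (hc : ∀ r ≤ M, B (n - (M - r), r) ≤ c₀ + c₁ * (2 * r - M)) :
    branchingOp (stackLaw ρ) (fun k => ENNReal.ofReal (B (0, k))) n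
      ≤ ENNReal.ofReal (c₀ + c₁ * ∫ p, ∑ i ∈ Finset.range M, (2 * (p i : ℝ) - 1) ∂ρ) := by
  -- Since `M ≤ n`, the search is still running while the `M` cookies are explored, so the state at
  -- time `M` depends on the number of right arrows only.
  have hstate : ∀ s : ℕ → Bool,
      B (stackState s n M) ≤ c₀ + c₁ * (2 * rights s M - M) := fun s => by
    have h1 := rights_add_lefts s M
    rw [stackState_eq]
    · have : n - lefts s M = n - (M - rights s M) := by omega
      rw [this]
      exact hc _ (by omega)
    · intro u hu
      have := rights_add_lefts s u
      omega
  have hle : ∀ s : ℕ → Bool, (rights s M : ℝ) ≤ M := fun s => by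
    have h1 := rights_add_lefts s M
    exact_mod_cast (by omega : rights s M ≤ M)
  have hint : Integrable (fun s => 2 * (rights s M : ℝ) - M) (stackLaw ρ) := by
    refine Integrable.of_bound (C := M) ?_ (ae_of_all _ fun s => ?_)
    · exact ((measurable_of_countable fun k : ℕ => 2 * (k : ℝ) - M).comp
        (measurable_rights M)).aestronglyMeasurable
    · have := hle s
      have h0 : (0 : ℝ) ≤ rights s M := Nat.cast_nonneg _
      rw [Real.norm_eq_abs, abs_le]
      constructor <;> linarith
  calc branchingOp (stackLaw ρ) (fun k => ENNReal.ofReal (B (0, k))) n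
      ≤ ∫⁻ s, ENNReal.ofReal (B (stackState s n M)) ∂(stackLaw ρ) := by
        refine lintegral_rightsBefore_stackLaw_le hρ (B := fun v => ENNReal.ofReal (B v))
          (fun k y => ?_) n
        have h2 : (2⁻¹ : ℝ≥0∞) = ENNReal.ofReal 2⁻¹ := by
          simp [ENNReal.ofReal_inv_of_pos]
        rw [h2, ← ENNReal.ofReal_mul (by norm_num), ← ENNReal.ofReal_mul (by norm_num),
          ← ENNReal.ofReal_add (mul_nonneg (by norm_num) (hB0 _))
            (mul_nonneg (by norm_num) (hB0 _))]
        exact ENNReal.ofReal_le_ofReal (by linarith [hB k y])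
    _ ≤ ∫⁻ s, ENNReal.ofReal (c₀ + c₁ * (2 * rights s M - M)) ∂(stackLaw ρ) :=
        lintegral_mono fun s => ENNReal.ofReal_le_ofReal (hstate s)
    _ = ENNReal.ofReal (∫ s, (c₀ + c₁ * (2 * (rights s M : ℝ) - M)) ∂(stackLaw ρ)) :=
        (ofReal_integral_eq_lintegral_ofReal ((integrable_const _).add (hint.const_mul _))
          (ae_of_all _ fun s => (hB0 _).trans (hstate s))).symm
    _ = _ := by
        rw [integral_add (integrable_const _) (hint.const_mul _), integral_const_mul,
          integral_rights_stackLaw]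
        simp

/-! ### Extinction for drift below one, survival for drift above one -/

section Branching

variable {Ω : Type*} [MeasurableSpace Ω] {μ : Measure Ω} [IsProbabilityMeasure μ]
  {σ : ℕ → Ω → ℕ → Bool}

/-- The branching process dies out if the drift is less than `1`. -/
lemma ae_branching_extinct (hρ : ∀ᵐ p ∂ρ, ∀ i, M ≤ i → (p i : ℝ) = 1 / 2)
    (hell : 0 < ρ {p | ∀ i, (p i : ℝ) < 1})
    (hδ : ∫ p, ∑ i ∈ Finset.range M, (2 * (p i : ℝ) - 1) ∂ρ < 1)
    (hind : iIndepFun σ μ) (hm : ∀ k, Measurable (σ k)) (hσ : ∀ k, μ.map (σ k) = stackLaw ρ)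
    (m : ℕ) : ∀ᵐ ω ∂μ, ∃ k, branching (fun k => σ k ω) m k = 0 := by
  obtain ⟨N, hMN, hN⟩ := exists_logSup_drift hδ M
  refine ae_exists_branching_eq_zero hind hm hσ (stackLaw_rightsBefore_pos hell)
    (L := fun k => logSup (0, k)) (fun k => logSup_nonneg _) ?_ (N := N) (fun n hn => ?_) m
  · simp only [logSup]
    refine (Real.tendsto_log_atTop.comp (tendsto_atTop_add_const_right _ 3
      tendsto_natCast_atTop_atTop)).congr fun n => ?_
    simp
  · obtain ⟨c₀, c₁, h1, h2⟩ := hN n hn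
    exact (branchingOp_stackLaw_le hρ logSup_nonneg logSup_super (hMN.trans hn) h1).trans
      (ENNReal.ofReal_le_ofReal h2)

/-- If the drift is greater than `1`, some branching process survives almost surely. -/
lemma ae_exists_branching_survives (hρ : ∀ᵐ p ∂ρ, ∀ i, M ≤ i → (p i : ℝ) = 1 / 2)
    (hδ : 1 < ∫ p, ∑ i ∈ Finset.range M, (2 * (p i : ℝ) - 1) ∂ρ)
    (hind : iIndepFun σ μ) (hm : ∀ k, Measurable (σ k)) (hσ : ∀ k, μ.map (σ k) = stackLaw ρ) :
    ∀ᵐ ω ∂μ, ∃ m, ∀ k, branching (fun k => σ k ω) m k ≠ 0 := by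
  obtain ⟨a, c, ha0, ha1, hc, N, hMN, hN⟩ := exists_powSup_drift hδ M
  have hc0 : 0 < c := lt_of_lt_of_le (by positivity) hc
  let f : ℕ → ℝ := fun n => powSup a c (0, n)
  have hf0 : ∀ n, 0 < f n := fun n => by
    simp only [f, powSup_zero_left]
    positivity
  have hfanti : Antitone f := fun n n' h => by
    simp only [f, powSup_zero_left]
    refine Real.rpow_le_rpow_of_nonpos (by positivity) ?_ (by linarith)
    have : (n : ℝ) ≤ n' := by exact_mod_cast h
    linarith
  have hflim : Tendsto f atTop (nhds 0) := by
    simp only [f, powSup_zero_left]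
    exact (tendsto_rpow_neg_atTop ha0).comp (tendsto_atTop_add_const_right _ c
      tendsto_natCast_atTop_atTop)
  let C : ℝ≥0∞ := (ENNReal.ofReal (f N))⁻¹
  have hfN : ENNReal.ofReal (f N) ≠ 0 := by simpa using hf0 N
  -- The normalization makes `g = 1` up to `N`, where the drift estimate is unavailable but the
  -- supersolution inequality is trivial.
  let g : ℕ → ℝ≥0∞ := fun n => min 1 (C * ENNReal.ofReal (f n))
  have hg1 : ∀ n ≤ N, g n = 1 := fun n hn => by
    refine min_eq_left ?_
    rw [← ENNReal.inv_mul_cancel hfN ENNReal.ofReal_ne_top]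
    exact mul_le_mul_right (ENNReal.ofReal_le_ofReal (hfanti hn)) _
  have hgsup : branchingOp (stackLaw ρ) g ≤ g := fun n => by
    have hle1 : branchingOp (stackLaw ρ) g n ≤ 1 := by
      calc branchingOp (stackLaw ρ) g n ≤ ∫⁻ _, 1 ∂(stackLaw ρ) :=
            lintegral_mono fun s => min_le_left _ _
        _ = 1 := by simp
    rcases le_or_gt n N with hn | hn
    · rwa [hg1 n hn]
    · refine le_min hle1 ?_
      obtain ⟨c₀, c₁, h1, h2⟩ := hN n hn.le
      have hmeas : Measurable fun s => ENNReal.ofReal (f (rightsBefore s n)) :=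
        (measurable_of_countable fun k => ENNReal.ofReal (f k)).comp (measurable_rightsBefore n)
      calc branchingOp (stackLaw ρ) g n
          ≤ ∫⁻ s, C * ENNReal.ofReal (f (rightsBefore s n)) ∂(stackLaw ρ) :=
            lintegral_mono fun s => min_le_right _ _
        _ = C * branchingOp (stackLaw ρ) (fun k => ENNReal.ofReal (f k)) n :=
            lintegral_const_mul _ hmeas
        _ ≤ C * ENNReal.ofReal (f n) := by
            refine mul_le_mul_right ?_ _
            exact (branchingOp_stackLaw_le hρ (powSup_nonneg ha0.le hc0.le)
              (powSup_super ha0 ha1 hc) (hMN.trans hn.le) h1).trans (ENNReal.ofReal_le_ofReal h2)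
  -- Extinction from every initial value implies extinction from `m`, for arbitrarily large `m`, and
  -- `g m` tends to zero.
  have hbound : ∀ m, μ {ω | ∀ m, ∃ k, branching (fun k => σ k ω) m k = 0} ≤ g m := fun m =>
    (measure_mono fun ω (hω : ∀ m, ∃ k, branching (fun k => σ k ω) m k = 0) => hω m).trans
      (measure_exists_branching_eq_zero_le hind hm hσ (hg1 0 (Nat.zero_le _)).ge hgsup m)
  have hglim : Tendsto g atTop (nhds 0) := by
    have h1 : Tendsto (fun n => C * ENNReal.ofReal (f n)) atTop (nhds (C * ENNReal.ofReal 0)) :=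
      ENNReal.Tendsto.const_mul (ENNReal.tendsto_ofReal hflim)
        (Or.inr (ENNReal.inv_ne_top.2 hfN))
    rw [ENNReal.ofReal_zero, mul_zero] at h1
    exact tendsto_of_tendsto_of_tendsto_of_le_of_le tendsto_const_nhds h1 (fun _ => zero_le)
      fun _ => min_le_right _ _
  have hzero : μ {ω | ∀ m, ∃ k, branching (fun k => σ k ω) m k = 0} = 0 :=
    le_antisymm (ge_of_tendsto' hglim hbound) zero_le
  rw [ae_iff, ← hzero]
  congr 1
  ext ω
  simp

end Branching

end Drift

/-! ### The averaged law of the excited walk as the law of the arrow walk -/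

/-- The position and the local times of the walk following the arrows `η`. -/
def walkState (η : ℤ → ℕ → Bool) (x : ℤ) : ℕ → ℤ × (ℤ → ℕ)
  | 0 => (x, fun _ => 0)
  | n + 1 =>
    ((walkState η x n).1
        + arrowSign (η (walkState η x n).1 ((walkState η x n).2 (walkState η x n).1)),
      fun z => (walkState η x n).2 z + if (walkState η x n).1 = z then 1 else 0)

/-- The walk started at `x` which follows the arrows `η`. -/
def stackWalk (x : ℤ) (η : ℤ → ℕ → Bool) (n : ℕ) : ℤ := (walkState η x n).1

lemma walkState_snd (η : ℤ → ℕ → Bool) (x : ℤ) (n : ℕ) (z : ℤ) :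
    (walkState η x n).2 z = visits (stackWalk x η) n z := by
  induction n with
  | zero => simp [walkState, visits_zero]
  | succ n ih => rw [visits_succ, ← ih]; rfl

lemma isStackWalk_stackWalk (η : ℤ → ℕ → Bool) (x : ℤ) : IsStackWalk η x (stackWalk x η) where
  start := rfl
  step n := by rw [← walkState_snd]; rfl

lemma measurable_walkState (x : ℤ) (n : ℕ) :
    Measurable fun η : ℤ → ℕ → Bool => walkState η x n := by
  induction n with
  | zero => exact measurable_const
  | succ n ih =>
    have h1 : Measurable fun q : (ℤ → ℕ) × ℤ => q.1 q.2 :=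
      measurable_from_prod_countable_left fun z => measurable_pi_apply z
    have h2 : Measurable fun q : (ℤ → ℕ → Bool) × (ℤ × ℕ) => q.1 q.2.1 q.2.2 :=
      measurable_from_prod_countable_left fun v =>
        (measurable_pi_apply v.2).comp (measurable_pi_apply v.1)
    have h3 : Measurable fun η : ℤ → ℕ → Bool =>
        (walkState η x n).2 (walkState η x n).1 := h1.comp (ih.snd.prodMk ih.fst)
    have h4 : Measurable fun η : ℤ → ℕ → Bool =>
        η (walkState η x n).1 ((walkState η x n).2 (walkState η x n).1) :=
      h2.comp (measurable_id.prodMk (ih.fst.prodMk h3))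
    refine Measurable.prodMk (ih.fst.add ((measurable_of_countable arrowSign).comp h4)) ?_
    refine measurable_pi_iff.2 fun z => ((measurable_pi_apply z).comp ih.snd).add ?_
    exact (measurable_of_countable fun y : ℤ => if y = z then 1 else 0).comp ih.fst

lemma measurable_stackWalk (x : ℤ) : Measurable (stackWalk x) :=
  measurable_pi_iff.2 fun n => (measurable_walkState x n).fst

lemma visits_congr {w w' : ℕ → ℤ} {n : ℕ} (h : ∀ i < n, w i = w' i) (z : ℤ) :
    visits w n z = visits w' n z := by
  unfold visits
  congr 1
  refine Finset.filter_congr fun i hi => ?_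
  rw [h i (Finset.mem_range.1 hi)]

/-- The arrows which lead along the first `n` steps of the path `a`. -/
def pathEvent (a : ℕ → ℤ) (n : ℕ) : Set (ℤ → ℕ → Bool) :=
  {η | ∀ j < n, a (j + 1) = a j + arrowSign (η (a j) (visits a j (a j)))}

lemma stackWalk_eq_iff (x : ℤ) (η : ℤ → ℕ → Bool) (a : ℕ → ℤ) (n : ℕ) :
    (∀ i ≤ n, stackWalk x η i = a i) ↔ a 0 = x ∧ η ∈ pathEvent a n := by
  have hw := isStackWalk_stackWalk η x
  constructor
  · intro h
    refine ⟨by rw [← h 0 (Nat.zero_le _), hw.start], fun j hj => ?_⟩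
    rw [← h (j + 1) hj, hw.step, h j hj.le, visits_congr fun i hi => h i (by omega)]
  · rintro ⟨h0, h⟩ i
    induction i using Nat.strong_induction_on with
    | _ i ih =>
      intro hi
      cases i with
      | zero => rw [hw.start, h0]
      | succ i =>
        rw [hw.step, h i hi, ih i (by omega) (by omega),
          visits_congr fun j hj => ih j (by omega) (by omega)]

/-- The probability that a cookie of strength `p` causes the displacement `d`. -/
noncomputable def stepWeight (p : unitInterval) (d : ℤ) : ℝ≥0∞ :=
  if d = 1 then ENNReal.ofReal p else if d = -1 then ENNReal.ofReal (1 - p) else 0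

lemma volume_arrowSign (p : unitInterval) (y z : ℤ) :
    volume {u : unitInterval | y = z + arrowSign (decide (u < p))} = stepWeight p (y - z) := by
  unfold stepWeight
  split_ifs with h1 h2
  · have : {u : unitInterval | y = z + arrowSign (decide (u < p))}
        = {u | decide (u < p) = true} := by
      ext u
      simp only [Set.mem_ofPred_eq]
      rcases arrowSign_eq (decide (u < p)) with ⟨h, hb⟩ | ⟨h, hb⟩ <;> rw [h, hb] <;> simp <;> omega
    rw [this, volume_decide_lt]
    simp [cookieWeight]
  · have : {u : unitInterval | y = z + arrowSign (decide (u < p))}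
        = {u | decide (u < p) = false} := by
      ext u
      simp only [Set.mem_ofPred_eq]
      rcases arrowSign_eq (decide (u < p)) with ⟨h, hb⟩ | ⟨h, hb⟩ <;> rw [h, hb] <;> simp <;> omega
    rw [this, volume_decide_lt]
    simp [cookieWeight]
  · have : {u : unitInterval | y = z + arrowSign (decide (u < p))} = ∅ := by
      ext u
      rcases arrowSign_eq (decide (u < p)) with h | h <;>
        simp only [Set.mem_ofPred_eq, h.1] <;> simp <;> omega
    rw [this, measure_empty]

lemma measurableSet_arrowSign (p : unitInterval) (y z : ℤ) :
    MeasurableSet {u : unitInterval | y = z + arrowSign (decide (u < p))} := by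
  have : Measurable fun u : unitInterval => z + arrowSign (decide (u < p)) :=
    (measurable_of_countable fun b : Bool => z + arrowSign b).comp
      (measurable_decide_lt.comp measurable_prodMk_right)
  exact measurableSet_eq_fun measurable_const this

lemma measurable_stepWeight (d : ℤ) : Measurable fun p => stepWeight p d := by
  unfold stepWeight
  split_ifs
  · exact measurable_subtype_coe.ennreal_ofReal
  · exact (measurable_const.sub measurable_subtype_coe).ennreal_ofReal
  · exact measurable_const

lemma visits_lt_of_lt {a : ℕ → ℤ} {i j : ℕ} (hij : i < j) : visits a i (a i) < visits a j (a i) := by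
  have h1 := visits_mono a (a i) (show i + 1 ≤ j from hij)
  simp only [visits_succ, if_true] at h1
  omega

lemma visits_injOn (a : ℕ → ℤ) (z : ℤ) : Set.InjOn (fun j => visits a j z) {j | a j = z} := by
  intro i (hi : a i = z) j (hj : a j = z) hij
  simp only at hij
  rcases lt_trichotomy i j with h | h | h
  · have := visits_lt_of_lt (a := a) h
    rw [hi] at this
    omega
  · exact h
  · have := visits_lt_of_lt (a := a) h
    rw [hj] at this
    omega

/-- The stacks at the site `z` which lead along the first `n` steps of the path `a`. -/
def siteEvent (a : ℕ → ℤ) (n : ℕ) (z : ℤ) : Set (ℕ → Bool) :=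
  {s | ∀ j ∈ (Finset.range n).filter fun j => a j = z,
    a (j + 1) = a j + arrowSign (s (visits a j z))}

lemma measurableSet_siteEvent (a : ℕ → ℤ) (n : ℕ) (z : ℤ) : MeasurableSet (siteEvent a n z) := by
  have : siteEvent a n z = ⋂ j ∈ (Finset.range n).filter fun j => a j = z,
      (fun s : ℕ → Bool => a j + arrowSign (s (visits a j z))) ⁻¹' {a (j + 1)} := by
    ext s
    simp only [siteEvent, Set.mem_ofPred_eq, Set.mem_iInter, Set.mem_preimage,
      Set.mem_singleton_iff, eq_comm]
  rw [this]
  refine Finset.measurableSet_biInter _ fun j _ => ?_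
  exact ((measurable_of_countable fun b => a j + arrowSign b).comp (measurable_pi_apply _))
    (measurableSet_singleton _)

/-- Different visits to `z` use different arrows, so the event constrains distinct independent
coordinates, one for each visit. -/
lemma uniformSeq_siteEvent (p : ℕ → unitInterval) (a : ℕ → ℤ) (n : ℕ) (z : ℤ) :
    uniformSeq {u | stackOf p u ∈ siteEvent a n z}
      = ∏ j ∈ (Finset.range n).filter fun j => a j = z,
          stepWeight (p (visits a j z)) (a (j + 1) - a j) := by
  classical
  set J := (Finset.range n).filter fun j => a j = z with hJ
  have hinj : Set.InjOn (fun j => visits a j z) J :=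
    (visits_injOn a z).mono fun j hj => (Finset.mem_filter.1 hj).2
  let t : ℕ → Set unitInterval := fun i =>
    ⋂ j ∈ J, ⋂ _ : visits a j z = i, {u | a (j + 1) = a j + arrowSign (decide (u < p i))}
  have ht : ∀ j ∈ J, t (visits a j z)
      = {u | a (j + 1) = a j + arrowSign (decide (u < p (visits a j z)))} := fun j hj => by
    ext u
    simp only [t, Set.mem_iInter]
    constructor
    · exact fun h => h j hj rfl
    · intro h i hi hij
      obtain rfl : i = j := hinj hi hj hij
      exact h
  have hpi : {u | stackOf p u ∈ siteEvent a n z}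
      = Set.pi ((J.image fun j => visits a j z : Finset ℕ) : Set ℕ) t := by
    ext u
    simp only [Set.mem_pi, Finset.mem_coe, Finset.mem_image, forall_exists_index, and_imp,
      forall_apply_eq_imp_iff₂]
    constructor
    · intro h j hj
      rw [ht j hj]
      exact h j hj
    · intro h j hj
      have := h j hj
      rw [ht j hj] at this
      exact this
  rw [hpi, uniformSeq, Measure.infinitePi_pi, Finset.prod_image hinj]
  · refine Finset.prod_congr rfl fun j hj => ?_
    rw [ht j hj, volume_arrowSign]
  · intro i hi
    obtain ⟨j, hj, rfl⟩ := Finset.mem_image.1 hi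
    rw [ht j hj]
    exact measurableSet_arrowSign _ _ _

/-- The law of the arrows: the stacks are independent with law `stackLaw ρ`. -/
noncomputable def arrowLaw (ρ : Measure (ℕ → unitInterval)) [IsProbabilityMeasure ρ] :
    Measure (ℤ → ℕ → Bool) :=
  Measure.infinitePi fun _ : ℤ => stackLaw ρ

instance (ρ : Measure (ℕ → unitInterval)) [IsProbabilityMeasure ρ] :
    IsProbabilityMeasure (arrowLaw ρ) := by unfold arrowLaw; infer_instance

lemma pathEvent_eq_pi (a : ℕ → ℤ) (n : ℕ) :
    pathEvent a n = Set.pi ((Finset.range n).image a : Finset ℤ) (siteEvent a n) := by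
  ext η
  simp only [pathEvent, siteEvent, Set.mem_pi, Set.mem_ofPred_eq, Finset.mem_coe,
    Finset.mem_image, Finset.mem_filter, Finset.mem_range]
  constructor
  · rintro h z - j ⟨hj, rfl⟩
    exact h j hj
  · exact fun h j hj => h (a j) ⟨j, hj, rfl⟩ j ⟨hj, rfl⟩

lemma arrowLaw_pi (ρ : Measure (ℕ → unitInterval)) [IsProbabilityMeasure ρ] (S : Finset ℤ)
    {A : ℤ → Set (ℕ → Bool)} (hA : ∀ z, MeasurableSet (A z)) :
    arrowLaw ρ (Set.pi S A) = ∏ z ∈ S, stackLaw ρ (A z) := by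
  rw [arrowLaw, Measure.infinitePi_pi]
  exact fun z _ => hA z

/-- The product of the weights of the steps of the path `a` taken at the site `z` before time `n`. -/
noncomputable def siteWeight (a : ℕ → ℤ) (n : ℕ) (z : ℤ) (p : ℕ → unitInterval) : ℝ≥0∞ :=
  ∏ j ∈ (Finset.range n).filter fun j => a j = z, stepWeight (p (visits a j z)) (a (j + 1) - a j)

lemma measurable_siteWeight (a : ℕ → ℤ) (n : ℕ) (z : ℤ) : Measurable (siteWeight a n z) :=
  Finset.measurable_prod _ fun _ _ => (measurable_stepWeight _).comp (measurable_pi_apply _)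

lemma prod_siteWeight (a : ℕ → ℤ) (n : ℕ) (ω : CookieEnv) :
    ∏ z ∈ (Finset.range n).image a, siteWeight a n z (ω z)
      = ∏ j ∈ Finset.range n, stepWeight (ω (a j) (visits a j (a j))) (a (j + 1) - a j) := by
  rw [← Finset.prod_fiberwise_of_maps_to (t := (Finset.range n).image a) (g := a)
    fun j hj => Finset.mem_image_of_mem a hj]
  refine Finset.prod_congr rfl fun z _ => Finset.prod_congr rfl fun j hj => ?_
  rw [(Finset.mem_filter.1 hj).2]

/-- The path event is a product over sites; independence of the cookie stacks turns the product of
the site expectations into the expectation of the product. -/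
lemma arrowLaw_pathEvent {P : Measure CookieEnv} [IsProbabilityMeasure P] (hP : CookieIID P)
    {ρ : Measure (ℕ → unitInterval)} [IsProbabilityMeasure ρ] (hρ : ρ = P.map fun ω => ω 0)
    (a : ℕ → ℤ) (n : ℕ) :
    arrowLaw ρ (pathEvent a n)
      = ∫⁻ ω, ∏ j ∈ Finset.range n, stepWeight (ω (a j) (visits a j (a j))) (a (j + 1) - a j) ∂P := by
  have hmeas : ∀ z, Measurable fun ω : CookieEnv => siteWeight a n z (ω z) := fun z =>
    (measurable_siteWeight a n z).comp (measurable_pi_apply z)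
  have hind : iIndepFun (fun z (ω : CookieEnv) => siteWeight a n z (ω z)) P :=
    hP.1.comp (siteWeight a n) (measurable_siteWeight a n)
  have hsite : ∀ z, stackLaw ρ (siteEvent a n z) = ∫⁻ ω, siteWeight a n z (ω z) ∂P := fun z => by
    rw [stackLaw_apply ρ (measurableSet_siteEvent a n z)]
    simp only [uniformSeq_siteEvent]
    rw [← lintegral_map (measurable_siteWeight a n z) (measurable_pi_apply z), (hP.2 z).map_eq, hρ]
    rfl
  rw [pathEvent_eq_pi, arrowLaw_pi ρ _ (measurableSet_siteEvent a n)]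
  simp only [hsite, ← prod_siteWeight]
  exact (lintegral_prod_eq_prod_lintegral_of_indepFun _ _ hind hmeas).symm

/-- Finite measures on the space of paths are determined by the probabilities of finite paths. -/
lemma pathMeasure_ext {m₁ m₂ : Measure (ℕ → ℤ)} [IsFiniteMeasure m₁] [IsFiniteMeasure m₂]
    (h : ∀ (a : ℕ → ℤ) (n : ℕ), m₁ {w | ∀ i ≤ n, w i = a i} = m₂ {w | ∀ i ≤ n, w i = a i}) :
    m₁ = m₂ := by
  -- Both measures are projective limits of the marginals of `m₂`; for `m₁` this need only be
  -- checked on initial segments, where singletons are path events.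
  let μ : (I : Finset ℕ) → Measure (I → ℤ) := fun I => m₂.map I.restrict
  have hμ : IsProjectiveMeasureFamily (α := fun _ : ℕ => ℤ) μ := fun I J hJI => by
    simp only [μ]
    rw [Measure.map_map (Finset.measurable_restrict₂ hJI) (Finset.measurable_restrict I)]
    rfl
  have h2 : IsProjectiveLimit (α := fun _ : ℕ => ℤ) m₂ μ := fun I => rfl
  have h1 : IsProjectiveLimit (α := fun _ : ℕ => ℤ) m₁ μ := by
    rw [isProjectiveLimit_nat_iff hμ]
    intro n
    refine Measure.ext_of_singleton fun b => ?_
    simp only [μ]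
    let a : ℕ → ℤ := fun i => if hi : i ∈ Finset.Iic n then b ⟨i, hi⟩ else 0
    have hpre : (Preorder.frestrictLe n : (ℕ → ℤ) → _) ⁻¹' {b} = {w | ∀ i ≤ n, w i = a i} := by
      ext w
      simp only [Set.mem_preimage, Set.mem_singleton_iff, Set.mem_ofPred_eq, funext_iff,
        Subtype.forall, Preorder.frestrictLe_apply, a]
      constructor
      · intro hw i hi
        rw [hw i (Finset.mem_Iic.2 hi), dif_pos (Finset.mem_Iic.2 hi)]
      · intro hw i hi
        rw [hw i (Finset.mem_Iic.1 hi), dif_pos hi]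
    rw [Measure.map_apply (Preorder.measurable_frestrictLe n) (measurableSet_singleton b),
      Measure.map_apply (Finset.measurable_restrict _) (measurableSet_singleton b)]
    change m₁ ((Preorder.frestrictLe n : (ℕ → ℤ) → _) ⁻¹' {b})
      = m₂ ((Preorder.frestrictLe n : (ℕ → ℤ) → _) ⁻¹' {b})
    rw [hpre, h]
  exact h1.unique h2

lemma measurableSet_path {Ω' : Type*} (X : ℕ → Ω' → ℤ) (a : ℕ → ℤ) (n : ℕ) :
    MeasurableSet[pastSigma X n] {w | ∀ i ≤ n, X i w = a i} := by
  have : {w | ∀ i ≤ n, X i w = a i} = ⋂ i ∈ Finset.range (n + 1), X i ⁻¹' {a i} := by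
    ext w
    simp
  rw [this]
  refine Finset.measurableSet_biInter _ fun i hi => ?_
  have hle : MeasurableSpace.comap (X i) inferInstance ≤ pastSigma X n :=
    le_iSup₂_of_le i hi le_rfl
  exact hle _ ⟨{a i}, measurableSet_singleton _, rfl⟩

namespace IsExcitedRandomWalk

variable {Ω' : Type*} [MeasurableSpace Ω'] {μ : Measure Ω'} {ω : CookieEnv} {x : ℤ}
  {X : ℕ → Ω' → ℤ}

lemma pastSigma_le (hX : IsExcitedRandomWalk μ ω x X) (n : ℕ) :
    pastSigma X n ≤ ‹MeasurableSpace Ω'› :=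
  iSup₂_le fun i _ => (hX.measurable i).comap_le

lemma measure_path_inter [IsProbabilityMeasure μ] {a : ℕ → ℤ} {n : ℕ} {A : Set Ω'} {q : ℝ}
    {g : Ω' → ℝ} (hm : pastSigma X n ≤ ‹MeasurableSpace Ω'›) (hA : MeasurableSet A)
    (hg : μ⟦A | pastSigma X n⟧ =ᵐ[μ] g) (hgq : ∀ w, (∀ i ≤ n, X i w = a i) → g w = q) :
    μ.real ({w | ∀ i ≤ n, X i w = a i} ∩ A) = q * μ.real {w | ∀ i ≤ n, X i w = a i} := by
  set E := {w | ∀ i ≤ n, X i w = a i} with hE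
  have hEm := measurableSet_path X a n
  have h1 := setIntegral_condExp hm (μ := μ) (f := A.indicator fun _ => (1 : ℝ))
    ((integrable_const 1).indicator hA) hEm
  have h2 : ∫ w in E, (μ⟦A | pastSigma X n⟧) w ∂μ = ∫ w in E, q ∂μ := by
    refine setIntegral_congr_ae (hm _ hEm) ?_
    filter_upwards [hg] with w hw hwE
    rw [hw, hgq w hwE]
  rw [h2, setIntegral_const, setIntegral_indicator hA, setIntegral_const] at h1
  simp only [smul_eq_mul, mul_one] at h1
  rw [← h1, mul_comm]

/-- On the event of a given past, the cookie used next is a constant, so each conditional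
probability contributes one factor. -/
lemma measure_path [IsProbabilityMeasure μ] (hX : IsExcitedRandomWalk μ ω x X) (a : ℕ → ℤ)
    (n : ℕ) : μ {w | ∀ i ≤ n, X i w = a i} = if a 0 = x then
      ∏ j ∈ Finset.range n, stepWeight (ω (a j) (visits a j (a j))) (a (j + 1) - a j) else 0 := by
  induction n with
  | zero =>
    split_ifs with h
    · rw [Finset.range_zero, Finset.prod_empty, ← prob_compl_eq_zero_iff]
      · filter_upwards [hX.start] with w hw
        intro i hi
        rw [Nat.le_zero.1 hi, hw, h]
      · exact hX.pastSigma_le 0 _ (measurableSet_path X a 0)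
    · refine measure_mono_null (t := {w | ¬ X 0 w = x}) (fun w hw hw' => h ?_) (ae_iff.1 hX.start)
      rw [← hw', hw 0 le_rfl]
  | succ n ih =>
    have hprior : ∀ w, (∀ i ≤ n, X i w = a i) →
        X n w = a n ∧ priorVisits X n w = visits a n (a n) := fun w hw => by
      refine ⟨hw n le_rfl, ?_⟩
      rw [← hw n le_rfl]
      exact visits_congr (w := fun i => X i w) (fun i hi => hw i hi.le) _
    set E := {w | ∀ i ≤ n, X i w = a i} with hE
    set p := ω (a n) (visits a n (a n)) with hp
    have hm := hX.pastSigma_le n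
    have hEm : MeasurableSet E := hm _ (measurableSet_path X a n)
    have hmR : MeasurableSet {w | X (n + 1) w = X n w + 1} :=
      measurableSet_eq_fun (hX.measurable _) ((hX.measurable _).add measurable_const)
    have hmL : MeasurableSet {w | X (n + 1) w = X n w - 1} :=
      measurableSet_eq_fun (hX.measurable _) ((hX.measurable _).sub measurable_const)
    have hR : μ.real (E ∩ {w | X (n + 1) w = X n w + 1}) = p * μ.real E :=
      measure_path_inter hm hmR (hX.step_right n) fun w hw => by
        rw [(hprior w hw).1, (hprior w hw).2]
    have hL : μ.real (E ∩ {w | X (n + 1) w = X n w - 1}) = (1 - p) * μ.real E :=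
      measure_path_inter hm hmL (hX.step_left n) fun w hw => by
        rw [(hprior w hw).1, (hprior w hw).2]
    have hsplit : {w | ∀ i ≤ n + 1, X i w = a i} = E ∩ {w | X (n + 1) w = a (n + 1)} := by
      ext w
      simp only [hE, Set.mem_inter_iff, Set.mem_ofPred_eq]
      constructor
      · exact fun h => ⟨fun i hi => h i (by omega), h _ le_rfl⟩
      · rintro ⟨h1, h2⟩ i hi
        rcases Nat.le_succ_iff.1 hi with h | rfl
        · exact h1 i h
        · exact h2
    have key : μ (E ∩ {w | X (n + 1) w = a (n + 1)}) = stepWeight p (a (n + 1) - a n) * μ E := by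
      unfold stepWeight
      split_ifs with h1 h2
      · have : E ∩ {w | X (n + 1) w = a (n + 1)} = E ∩ {w | X (n + 1) w = X n w + 1} := by
          ext w
          simp only [Set.mem_inter_iff, Set.mem_ofPred_eq, and_congr_right_iff]
          intro hw
          rw [(hprior w hw).1]
          constructor <;> intro h <;> omega
        rw [this, ← ofReal_measureReal, hR, ENNReal.ofReal_mul p.2.1, ofReal_measureReal]
      · have : E ∩ {w | X (n + 1) w = a (n + 1)} = E ∩ {w | X (n + 1) w = X n w - 1} := by
          ext w
          simp only [Set.mem_inter_iff, Set.mem_ofPred_eq, and_congr_right_iff]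
          intro hw
          rw [(hprior w hw).1]
          constructor <;> intro h <;> omega
        rw [this, ← ofReal_measureReal, hL, ENNReal.ofReal_mul (sub_nonneg.2 p.2.2),
          ofReal_measureReal]
      -- The probabilities of the two unit steps add up to one, so any other increment has
      -- probability zero.
      · rw [zero_mul]
        set R := E ∩ {w | X (n + 1) w = X n w + 1} with hRdef
        set L := E ∩ {w | X (n + 1) w = X n w - 1} with hLdef
        have hdisj : Disjoint R L := by
          rw [Set.disjoint_left]
          rintro w ⟨_, hw1⟩ ⟨_, hw2⟩
          simp only [Set.mem_ofPred_eq] at hw1 hw2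
          omega
        have hsum : μ.real (R ∪ L) = μ.real E := by
          rw [measureReal_union hdisj (hEm.inter hmL), hR, hL]
          ring
        have hdiff : μ.real (E \ (R ∪ L)) = 0 := by
          rw [measureReal_sdiff (Set.union_subset Set.inter_subset_left Set.inter_subset_left)
            ((hEm.inter hmR).union (hEm.inter hmL)), hsum, sub_self]
        refine measure_mono_null ?_ ((measureReal_eq_zero_iff).1 hdiff)
        rintro w ⟨hw, hw'⟩
        refine ⟨hw, ?_⟩
        have h3 := (hprior w hw).1
        simp only [Set.mem_ofPred_eq] at hw'
        rintro (⟨_, h⟩ | ⟨_, h⟩) <;> simp only [Set.mem_ofPred_eq] at h <;> omega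
    rw [hsplit, key, ih]
    split_ifs
    · rw [Finset.prod_range_succ, mul_comm]
    · rw [mul_zero]

end IsExcitedRandomWalk

/-- The averaged law of the excited random walk is the law of the walk following the arrows. -/
lemma map_compProd_eq_map_arrowLaw {P : Measure CookieEnv} [IsProbabilityMeasure P]
    (hP : CookieIID P) {ρ : Measure (ℕ → unitInterval)} [IsProbabilityMeasure ρ]
    (hρ : ρ = P.map fun ω => ω 0) {Ω' : Type*} [MeasurableSpace Ω'] (κ : Kernel CookieEnv Ω')
    [IsMarkovKernel κ] {x : ℤ} {X : ℕ → Ω' → ℤ} (hX : ∀ ω, IsExcitedRandomWalk (κ ω) ω x X) :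
    (P ⊗ₘ κ).map (fun p n => X n p.2) = (arrowLaw ρ).map (stackWalk x) := by
  have : Nonempty CookieEnv := ⟨fun _ _ => 0⟩
  have hXm : Measurable fun (p : CookieEnv × Ω') n => X n p.2 :=
    measurable_pi_iff.2 fun n => ((hX (Classical.arbitrary _)).measurable n).comp measurable_snd
  have := Measure.isProbabilityMeasure_map (μ := P ⊗ₘ κ) hXm.aemeasurable
  have := Measure.isProbabilityMeasure_map (μ := arrowLaw ρ) (measurable_stackWalk x).aemeasurable
  refine pathMeasure_ext fun a n => ?_
  have hset : MeasurableSet {w : ℕ → ℤ | ∀ i ≤ n, w i = a i} := by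
    have : {w : ℕ → ℤ | ∀ i ≤ n, w i = a i}
        = ⋂ i ∈ Set.Iic n, (fun w : ℕ → ℤ => w i) ⁻¹' {a i} := by
      ext w
      simp
    rw [this]
    exact MeasurableSet.biInter (Set.to_countable _) fun i _ =>
      measurable_pi_apply i (measurableSet_singleton _)
  rw [Measure.map_apply hXm hset, Measure.map_apply (measurable_stackWalk x) hset,
    Measure.compProd_apply (hXm hset)]
  have hq : ∀ ω, κ ω (Prod.mk ω ⁻¹' ((fun (p : CookieEnv × Ω') n => X n p.2) ⁻¹'
      {w | ∀ i ≤ n, w i = a i})) = if a 0 = x then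
      ∏ j ∈ Finset.range n, stepWeight (ω (a j) (visits a j (a j))) (a (j + 1) - a j) else 0 :=
    fun ω => (hX ω).measure_path a n
  simp only [hq]
  have hw : stackWalk x ⁻¹' {w | ∀ i ≤ n, w i = a i} = {η | a 0 = x ∧ η ∈ pathEvent a n} := by
    ext η
    exact stackWalk_eq_iff x η a n
  rw [hw]
  by_cases h0 : a 0 = x
  · simp only [h0, if_true, true_and]
    exact (arrowLaw_pathEvent hP hρ a n).symm
  · simp [h0]

lemma ae_goodStack_arrowLaw {ρ : Measure (ℕ → unitInterval)} [IsProbabilityMeasure ρ] {M : ℕ}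
    (hρ : ∀ᵐ p ∂ρ, ∀ i, M ≤ i → (p i : ℝ) = 1 / 2) :
    ∀ᵐ η ∂(arrowLaw ρ), ∀ z, GoodStack (η z) :=
  ae_all_iff.2 fun z => (measurePreserving_eval_infinitePi (fun _ : ℤ => stackLaw ρ)
    z).quasiMeasurePreserving.ae (ae_goodStack_stackLaw hρ)

lemma iIndepFun_arrowLaw (ρ : Measure (ℕ → unitInterval)) [IsProbabilityMeasure ρ] (x : ℤ) :
    iIndepFun (fun (k : ℕ) (η : ℤ → ℕ → Bool) => η (x + 1 + k)) (arrowLaw ρ) := by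
  have h : iIndepFun (fun (z : ℤ) (η : ℤ → ℕ → Bool) => η z) (arrowLaw ρ) :=
    iIndepFun_infinitePi (X := fun _ s => s) fun _ => measurable_id
  exact h.precomp (g := fun k : ℕ => x + 1 + (k : ℤ)) fun k l hkl => by
    simpa using hkl

lemma arrowLaw_map_eval (ρ : Measure (ℕ → unitInterval)) [IsProbabilityMeasure ρ] (z : ℤ) :
    (arrowLaw ρ).map (fun η => η z) = stackLaw ρ :=
  Measure.infinitePi_map_eval (fun _ : ℤ => stackLaw ρ) z

/-! ### Transfer to the excited walk and the one-sided conclusions -/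

lemma measurableSet_tendsto_atTop_int : MeasurableSet {w : ℕ → ℤ | Tendsto w atTop atTop} := by
  have : {w : ℕ → ℤ | Tendsto w atTop atTop}
      = ⋂ b : ℤ, ⋃ N : ℕ, ⋂ n ∈ Set.Ici N, (fun w : ℕ → ℤ => w n) ⁻¹' Set.Ici b := by
    ext w
    simp [tendsto_atTop, eventually_atTop]
  rw [this]
  exact MeasurableSet.iInter fun b => MeasurableSet.iUnion fun N =>
    MeasurableSet.biInter (Set.to_countable _) fun n _ => measurable_pi_apply n measurableSet_Ici

lemma measurableSet_tendsto_atBot_int : MeasurableSet {w : ℕ → ℤ | Tendsto w atTop atBot} := by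
  have : {w : ℕ → ℤ | Tendsto w atTop atBot}
      = ⋂ b : ℤ, ⋃ N : ℕ, ⋂ n ∈ Set.Ici N, (fun w : ℕ → ℤ => w n) ⁻¹' Set.Iic b := by
    ext w
    simp [tendsto_atBot, eventually_atTop]
  rw [this]
  exact MeasurableSet.iInter fun b => MeasurableSet.iUnion fun N =>
    MeasurableSet.biInter (Set.to_countable _) fun n _ => measurable_pi_apply n measurableSet_Iic

lemma measurableSet_frequently_eq (x : ℤ) :
    MeasurableSet {w : ℕ → ℤ | ∃ᶠ n in atTop, w n = x} := by
  have : {w : ℕ → ℤ | ∃ᶠ n in atTop, w n = x}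
      = ⋂ N : ℕ, ⋃ n ∈ Set.Ici N, (fun w : ℕ → ℤ => w n) ⁻¹' {x} := by
    ext w
    simp [frequently_atTop]
  rw [this]
  exact MeasurableSet.iInter fun N => MeasurableSet.biUnion (Set.to_countable _) fun n _ =>
    measurable_pi_apply n (measurableSet_singleton x)

section OneSided

variable {P : Measure CookieEnv} {M : ℕ}

lemma measurable_stack_zero : Measurable fun ω : CookieEnv => ω 0 := measurable_pi_apply 0

lemma CookieBD.ae_stack (hBD : CookieBD M P) :
    ∀ᵐ p ∂(P.map fun ω => ω 0), ∀ i, M ≤ i → (p i : ℝ) = 1 / 2 := by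
  have hset : MeasurableSet {p : ℕ → unitInterval | ∀ i, M ≤ i → (p i : ℝ) = 1 / 2} := by
    have : {p : ℕ → unitInterval | ∀ i, M ≤ i → (p i : ℝ) = 1 / 2}
        = ⋂ i ∈ Set.Ici M, (fun p : ℕ → unitInterval => (p i : ℝ)) ⁻¹' {1 / 2} := by
      ext p
      simp
    rw [this]
    exact MeasurableSet.biInter (Set.to_countable _) fun i _ =>
      (measurable_subtype_coe.comp (measurable_pi_apply i)) (measurableSet_singleton _)
  rw [ae_map_iff measurable_stack_zero.aemeasurable hset]
  filter_upwards [hBD] with ω hω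
  exact hω 0

lemma CookieBD.cookieDrift_eq (hBD : CookieBD M P) :
    cookieDrift P = ∫ ω, ∑ i ∈ Finset.range M, (2 * (ω 0 i : ℝ) - 1) ∂P := by
  refine integral_congr_ae ?_
  filter_upwards [hBD] with ω hω
  refine tsum_eq_sum fun i hi => ?_
  rw [hω 0 i (by simpa using hi)]
  norm_num

lemma measurable_stackDrift (M : ℕ) :
    Measurable fun p : ℕ → unitInterval => ∑ i ∈ Finset.range M, (2 * (p i : ℝ) - 1) :=
  Finset.measurable_sum _ fun i _ =>
    ((measurable_subtype_coe.comp (measurable_pi_apply i)).const_mul 2).sub_const 1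

lemma CookieBD.integral_stack (hBD : CookieBD M P) :
    ∫ p, ∑ i ∈ Finset.range M, (2 * (p i : ℝ) - 1) ∂(P.map fun ω => ω 0) = cookieDrift P := by
  rw [hBD.cookieDrift_eq, integral_map (measurable_pi_apply 0).aemeasurable
    (measurable_stackDrift M).aestronglyMeasurable]

variable [IsProbabilityMeasure P] {Ω' : Type*} [MeasurableSpace Ω'] {κ : Kernel CookieEnv Ω'}
  {x : ℤ} {X : ℕ → Ω' → ℤ}

lemma IsExcitedRandomWalk.measurable_path (hX : ∀ ω, IsExcitedRandomWalk (κ ω) ω x X) :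
    Measurable fun (p : CookieEnv × Ω') n => X n p.2 :=
  measurable_pi_iff.2 fun n => ((hX fun _ _ => 0).measurable n).comp measurable_snd

variable [IsMarkovKernel κ]

/-- Almost sure properties of the walk following the arrows are almost sure properties of the
excited random walk. -/
lemma ae_of_ae_arrowLaw (hIID : CookieIID P) (hX : ∀ ω, IsExcitedRandomWalk (κ ω) ω x X)
    [IsProbabilityMeasure (P.map fun ω => ω 0)] {C : (ℕ → ℤ) → Prop} (hC : MeasurableSet {w | C w})
    (h : ∀ᵐ η ∂(arrowLaw (P.map fun ω => ω 0)), C (stackWalk x η)) :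
    ∀ᵐ p ∂(P ⊗ₘ κ), C fun n => X n p.2 := by
  refine ae_of_ae_map (IsExcitedRandomWalk.measurable_path hX).aemeasurable (p := C) ?_
  rw [map_compProd_eq_map_arrowLaw hIID rfl κ hX, ae_map_iff
    (measurable_stackWalk x).aemeasurable hC]
  exact h

lemma isProbabilityMeasure_stack : IsProbabilityMeasure (P.map fun ω => ω 0) :=
  Measure.isProbabilityMeasure_map (measurable_pi_apply 0).aemeasurable

lemma ae_trichotomy (hIID : CookieIID P) (hBD : CookieBD M P)
    (hX : ∀ ω, IsExcitedRandomWalk (κ ω) ω x X) :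
    ∀ᵐ p ∂(P ⊗ₘ κ), (∃ᶠ n in atTop, X n p.2 = x) ∨ Tendsto (fun n => X n p.2) atTop atTop ∨
      Tendsto (fun n => X n p.2) atTop atBot := by
  have := isProbabilityMeasure_stack (P := P)
  refine ae_of_ae_arrowLaw hIID hX (C := fun w => (∃ᶠ n in atTop, w n = x) ∨
    Tendsto w atTop atTop ∨ Tendsto w atTop atBot) ((measurableSet_frequently_eq x).union
      (measurableSet_tendsto_atTop_int.union measurableSet_tendsto_atBot_int)) ?_
  filter_upwards [ae_goodStack_arrowLaw hBD.ae_stack] with η hη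
  exact (isStackWalk_stackWalk η x).trichotomy hη

/-- If the drift is less than `1`, the walk is not transient to the right. -/
lemma ae_not_tendsto_atTop (hIID : CookieIID P) (hWEL : CookieWEL P) (hBD : CookieBD M P)
    (hX : ∀ ω, IsExcitedRandomWalk (κ ω) ω x X) (hδ : cookieDrift P < 1) :
    ∀ᵐ p ∂(P ⊗ₘ κ), ¬ Tendsto (fun n => X n p.2) atTop atTop := by
  have := isProbabilityMeasure_stack (P := P)
  refine ae_of_ae_arrowLaw hIID hX (C := fun w => ¬ Tendsto w atTop atTop)
    measurableSet_tendsto_atTop_int.compl ?_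
  have hell : 0 < (P.map fun ω => ω 0) {p | ∀ i, (p i : ℝ) < 1} :=
    (hWEL 0).2.trans_le (Measure.le_map_apply (measurable_pi_apply 0).aemeasurable _)
  have hext := ae_all_iff.2 fun m => ae_branching_extinct hBD.ae_stack hell
    (hBD.integral_stack ▸ hδ) (iIndepFun_arrowLaw (P.map fun ω => ω 0) x)
    (fun k => measurable_pi_apply _) (fun k => arrowLaw_map_eval _ _) m
  filter_upwards [ae_goodStack_arrowLaw hBD.ae_stack, hext] with η hη hη' hlim
  obtain ⟨m, hm⟩ := (isStackWalk_stackWalk η x).exists_branching_pos hη hlim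
  obtain ⟨k, hk⟩ := hη' m
  exact (hm k).ne' hk

/-- If the drift is greater than `1`, the walk is not recurrent. -/
lemma ae_not_frequently (hIID : CookieIID P) (hBD : CookieBD M P)
    (hX : ∀ ω, IsExcitedRandomWalk (κ ω) ω x X) (hδ : 1 < cookieDrift P) :
    ∀ᵐ p ∂(P ⊗ₘ κ), ¬ ∃ᶠ n in atTop, X n p.2 = x := by
  have := isProbabilityMeasure_stack (P := P)
  refine ae_of_ae_arrowLaw hIID hX (C := fun w => ¬ ∃ᶠ n in atTop, w n = x)
    (measurableSet_frequently_eq x).compl ?_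
  have hsurv := ae_exists_branching_survives hBD.ae_stack
    (hBD.integral_stack ▸ hδ) (iIndepFun_arrowLaw (P.map fun ω => ω 0) x)
    (fun k => measurable_pi_apply _) (fun k => arrowLaw_map_eval _ _)
  filter_upwards [ae_goodStack_arrowLaw hBD.ae_stack, hsurv] with η hη hη' hrec
  obtain ⟨m, hm⟩ := hη'
  obtain ⟨k, hk⟩ := (isStackWalk_stackWalk η x).exists_branching_eq_zero hη hrec m
  exact hm k hk

end OneSided

/-! ### Reflection of the environment and of the walk -/

/-- The cookie environment seen in a mirror. -/
def mirrorEnv (ω : CookieEnv) : CookieEnv := fun z i => unitInterval.symm (ω (-z) i)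

lemma mirrorEnv_mirrorEnv (ω : CookieEnv) : mirrorEnv (mirrorEnv ω) = ω := by
  funext z i
  simp [mirrorEnv]

lemma measurable_mirrorEnv : Measurable mirrorEnv :=
  measurable_pi_iff.2 fun z => measurable_pi_iff.2 fun i =>
    unitInterval.continuous_symm.measurable.comp
      ((measurable_pi_apply i).comp (measurable_pi_apply (-z)))

/-- The stack of cookies seen in a mirror. -/
def mirrorStack (p : ℕ → unitInterval) : ℕ → unitInterval := fun i => unitInterval.symm (p i)

lemma measurable_mirrorStack : Measurable mirrorStack :=
  measurable_pi_iff.2 fun i => unitInterval.continuous_symm.measurable.comp (measurable_pi_apply i)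

section Mirror

variable {P : Measure CookieEnv} {M : ℕ}

lemma CookieIID.mirror [IsProbabilityMeasure P] (h : CookieIID P) : CookieIID (P.map mirrorEnv) := by
  have hind : iIndepFun (fun z ω => mirrorEnv ω z) P :=
    (h.1.precomp (g := fun z : ℤ => -z) neg_injective).comp (fun _ => mirrorStack)
      fun _ => measurable_mirrorStack
  have hmap : ∀ z : ℤ, (P.map mirrorEnv).map (fun ω => ω z) = P.map fun ω => mirrorEnv ω z :=
    fun z => Measure.map_map (measurable_pi_apply z) measurable_mirrorEnv
  have hmeas : ∀ z : ℤ, Measurable fun ω => mirrorEnv ω z := fun z =>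
    (measurable_pi_apply z).comp measurable_mirrorEnv
  have := Measure.isProbabilityMeasure_map (μ := P) measurable_mirrorEnv.aemeasurable
  constructor
  · rw [iIndepFun_iff_map_fun_eq_infinitePi_map fun z => measurable_pi_apply z]
    simp only [hmap]
    rw [← hind.map_fun_eq_infinitePi_map hmeas]
    exact Measure.map_id
  · intro z
    refine ⟨(measurable_pi_apply z).aemeasurable, (measurable_pi_apply 0).aemeasurable, ?_⟩
    rw [hmap, hmap]
    have e : ∀ z : ℤ, (P.map fun ω => mirrorEnv ω z) = (P.map fun ω => ω 0).map mirrorStack :=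
      fun z => by
        rw [← (h.2 (-z)).map_eq, Measure.map_map measurable_mirrorStack (measurable_pi_apply _)]
        rfl
    rw [e, e]

lemma CookieWEL.mirror (h : CookieWEL P) : CookieWEL (P.map mirrorEnv) := by
  intro z
  have hle := fun A => Measure.le_map_apply (μ := P) measurable_mirrorEnv.aemeasurable A
  have h1 : {ω : CookieEnv | ∀ i, (ω (-z) i : ℝ) < 1}
      = mirrorEnv ⁻¹' {ω | ∀ i, 0 < (ω z i : ℝ)} := by
    ext ω
    simp only [mirrorEnv, Set.mem_ofPred_eq, Set.mem_preimage, unitInterval.coe_symm_eq, sub_pos]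
  have h2 : {ω : CookieEnv | ∀ i, 0 < (ω (-z) i : ℝ)}
      = mirrorEnv ⁻¹' {ω | ∀ i, (ω z i : ℝ) < 1} := by
    ext ω
    simp only [mirrorEnv, Set.mem_ofPred_eq, Set.mem_preimage, unitInterval.coe_symm_eq,
      sub_lt_self_iff]
  exact ⟨(h1 ▸ (h (-z)).2).trans_le (hle _), (h2 ▸ (h (-z)).1).trans_le (hle _)⟩

lemma CookieBD.mirror (h : CookieBD M P) : CookieBD M (P.map mirrorEnv) := by
  have hset : MeasurableSet {ω : CookieEnv | ∀ z : ℤ, ∀ i, M ≤ i → (ω z i : ℝ) = 1 / 2} := by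
    have : {ω : CookieEnv | ∀ z : ℤ, ∀ i, M ≤ i → (ω z i : ℝ) = 1 / 2}
        = ⋂ z : ℤ, ⋂ i ∈ Set.Ici M, (fun ω : CookieEnv => (ω z i : ℝ)) ⁻¹' {1 / 2} := by
      ext ω
      simp
    rw [this]
    exact MeasurableSet.iInter fun z => MeasurableSet.biInter (Set.to_countable _) fun i _ =>
      (measurable_subtype_coe.comp ((measurable_pi_apply i).comp (measurable_pi_apply z)))
        (measurableSet_singleton _)
  rw [CookieBD, ae_map_iff measurable_mirrorEnv.aemeasurable hset]
  filter_upwards [h] with ω hω z i hi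
  have := hω (-z) i hi
  simp only [mirrorEnv, unitInterval.coe_symm_eq, this]
  norm_num

lemma CookieBD.cookieDrift_mirror (h : CookieBD M P) :
    cookieDrift (P.map mirrorEnv) = -cookieDrift P := by
  have hm : Measurable fun ω : CookieEnv => ∑ i ∈ Finset.range M, (2 * (ω 0 i : ℝ) - 1) :=
    (measurable_stackDrift M).comp measurable_stack_zero
  rw [h.mirror.cookieDrift_eq, h.cookieDrift_eq, ← integral_neg,
    integral_map measurable_mirrorEnv.aemeasurable hm.aestronglyMeasurable]
  refine integral_congr_ae (ae_of_all _ fun ω => ?_)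
  simp only [mirrorEnv, neg_zero, unitInterval.coe_symm_eq, ← Finset.sum_neg_distrib]
  exact Finset.sum_congr rfl fun i _ => by ring

end Mirror

lemma pastSigma_neg {Ω' : Type*} (X : ℕ → Ω' → ℤ) (n : ℕ) :
    pastSigma (fun n w => -X n w) n = pastSigma X n := by
  unfold pastSigma
  refine iSup_congr fun i => iSup_congr fun _ => ?_
  refine le_antisymm (Measurable.comap_le ?_) (Measurable.comap_le ?_)
  · exact measurable_neg.comp (comap_measurable (X i))
  · have h := measurable_neg.comp (comap_measurable fun w => -X i w)
    simpa [Function.comp_def] using h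

lemma IsExcitedRandomWalk.mirror {Ω' : Type*} [MeasurableSpace Ω'] {μ : Measure Ω'}
    {ω : CookieEnv} {x : ℤ} {X : ℕ → Ω' → ℤ} (h : IsExcitedRandomWalk μ (mirrorEnv ω) x X) :
    IsExcitedRandomWalk μ ω (-x) fun n w => -X n w where
  measurable n := (h.measurable n).neg
  start := by
    filter_upwards [h.start] with w hw
    rw [hw]
  step_right n := by
    have hs : {w | -X (n + 1) w = -X n w + 1} = {w | X (n + 1) w = X n w - 1} := by
      ext w
      simp only [Set.mem_ofPred_eq]
      omega
    rw [hs, pastSigma_neg]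
    filter_upwards [h.step_left n] with w hw
    rw [hw]
    simp [mirrorEnv, priorVisits]
  step_left n := by
    have hs : {w | -X (n + 1) w = -X n w - 1} = {w | X (n + 1) w = X n w + 1} := by
      ext w
      simp only [Set.mem_ofPred_eq]
      omega
    rw [hs, pastSigma_neg]
    filter_upwards [h.step_right n] with w hw
    rw [hw]
    simp [mirrorEnv, priorVisits]

/-! ### The reflected conclusions and the theorem -/

section Main

variable {P : Measure CookieEnv} [IsProbabilityMeasure P] {M : ℕ} {Ω' : Type*}
  [MeasurableSpace Ω'] {κ : Kernel CookieEnv Ω'} [IsMarkovKernel κ] {x : ℤ} {X : ℕ → Ω' → ℤ}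

/-- Reflection is an involution, so the pulled-back kernel at the mirrored environment is again `κ
ω`: only the labelling of environments changes. -/
lemma ae_of_ae_mirror (hX : ∀ ω, IsExcitedRandomWalk (κ ω) ω x X) {C : (ℕ → ℤ) → Prop}
    (hC : MeasurableSet {w | C w})
    (h : ∀ᵐ p ∂(P.map mirrorEnv ⊗ₘ κ.comap mirrorEnv measurable_mirrorEnv), C fun n => X n p.2) :
    ∀ᵐ p ∂(P ⊗ₘ κ), C fun n => X n p.2 := by
  have := Measure.isProbabilityMeasure_map (μ := P) measurable_mirrorEnv.aemeasurable
  refine Measure.ae_compProd_of_ae_ae (IsExcitedRandomWalk.measurable_path hX hC) ?_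
  have h1 := ae_of_ae_map measurable_mirrorEnv.aemeasurable (Measure.ae_ae_of_ae_compProd h)
  filter_upwards [h1] with ω hω
  rwa [Kernel.comap_apply, mirrorEnv_mirrorEnv] at hω

/-- If the drift is greater than `-1`, the walk is not transient to the left. -/
lemma ae_not_tendsto_atBot (hIID : CookieIID P) (hWEL : CookieWEL P) (hBD : CookieBD M P)
    (hX : ∀ ω, IsExcitedRandomWalk (κ ω) ω x X) (hδ : -1 < cookieDrift P) :
    ∀ᵐ p ∂(P ⊗ₘ κ), ¬ Tendsto (fun n => X n p.2) atTop atBot := by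
  have := Measure.isProbabilityMeasure_map (μ := P) measurable_mirrorEnv.aemeasurable
  refine ae_of_ae_mirror hX (C := fun w => ¬ Tendsto w atTop atBot)
    measurableSet_tendsto_atBot_int.compl ?_
  filter_upwards [ae_not_tendsto_atTop hIID.mirror hWEL.mirror hBD.mirror
    (κ := κ.comap mirrorEnv measurable_mirrorEnv) (fun ω => (hX (mirrorEnv ω)).mirror)
    (by rw [hBD.cookieDrift_mirror]; linarith)] with p hp hlim
  exact hp (tendsto_neg_atBot_atTop.comp hlim)

/-- If the drift is less than `-1`, the walk is not recurrent. -/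
lemma ae_not_frequently_of_lt_neg_one (hIID : CookieIID P) (hBD : CookieBD M P)
    (hX : ∀ ω, IsExcitedRandomWalk (κ ω) ω x X) (hδ : cookieDrift P < -1) :
    ∀ᵐ p ∂(P ⊗ₘ κ), ¬ ∃ᶠ n in atTop, X n p.2 = x := by
  have := Measure.isProbabilityMeasure_map (μ := P) measurable_mirrorEnv.aemeasurable
  refine ae_of_ae_mirror hX (C := fun w => ¬ ∃ᶠ n in atTop, w n = x)
    (measurableSet_frequently_eq x).compl ?_
  filter_upwards [ae_not_frequently hIID.mirror hBD.mirror
    (κ := κ.comap mirrorEnv measurable_mirrorEnv) (fun ω => (hX (mirrorEnv ω)).mirror)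
    (by rw [hBD.cookieDrift_mirror]; linarith)] with p hp
  simpa using hp

end Main

/-- `κ ω` is the quenched measure in the environment `ω`, and `P ⊗ₘ κ` is the averaged measure. -/
theorem mainTheorem7 (P : Measure CookieEnv) [IsProbabilityMeasure P] (M : ℕ)
    (hIID : CookieIID P) (hWEL : CookieWEL P) (hBD : CookieBD M P)
    {Ω' : Type*} [MeasurableSpace Ω'] (κ : Kernel CookieEnv Ω') [IsMarkovKernel κ]
    (x : ℤ) (X : ℕ → Ω' → ℤ) (hX : ∀ ω, IsExcitedRandomWalk (κ ω) ω x X) :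
    (|cookieDrift P| < 1 → ∀ᵐ p ∂(P ⊗ₘ κ), ∃ᶠ n in atTop, X n p.2 = x) ∧
    (1 < cookieDrift P → ∀ᵐ p ∂(P ⊗ₘ κ), Tendsto (fun n => X n p.2) atTop atTop) ∧
    (cookieDrift P < -1 → ∀ᵐ p ∂(P ⊗ₘ κ), Tendsto (fun n => X n p.2) atTop atBot) := by

  have htri := ae_trichotomy hIID hBD hX
  refine ⟨fun hδ => ?_, fun hδ => ?_, fun hδ => ?_⟩
  · obtain ⟨h1, h2⟩ := abs_lt.1 hδ
    filter_upwards [htri, ae_not_tendsto_atTop hIID hWEL hBD hX h2,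
      ae_not_tendsto_atBot hIID hWEL hBD hX h1] with p hp hp1 hp2
    exact hp.resolve_right (not_or.2 ⟨hp1, hp2⟩)
  · filter_upwards [htri, ae_not_frequently hIID hBD hX hδ,
      ae_not_tendsto_atBot hIID hWEL hBD hX (by linarith)] with p hp hp1 hp2
    exact (hp.resolve_left hp1).resolve_right hp2
  · filter_upwards [htri, ae_not_frequently_of_lt_neg_one hIID hBD hX hδ,
      ae_not_tendsto_atTop hIID hWEL hBD hX (by linarith)] with p hp hp1 hp2
    exact (hp.resolve_left hp1).resolve_left hp2
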